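/- For graph classes $\mathcal C_1,\mathcal C_2$, the vertex deletion problem $\mathcal C_1\to\mathcal C_2$ is: given a finite simple graph $G$ in $\mathcal C_1$, find a set $V_-\subseteq V(G)$ of minimum cardinality such that $G-V_-$ (the subgraph induced by $V(G)\setminus V_-$) is in $\mathcal C_2$. A graph is split if its vertex set is the disjoint union of a clique and an independent set, either of which may be empty; it is $\{2K_2,P_3\}$-free if no induced subgraph of it is isomorphic to $2K_2$ (two disjoint edges) or to $P_3$ (the path on three vertices). Theorem. The vertex deletion problem from split graphs to $\{2K_2,P_3\}$-free graphs is in P: there are an algorithm and a polynomial $p$ such that, for every split graph $G$ on $n$ vertices, given by its adjacency matrix alone (without a split partition), the algorithm halts after at most $p(n)$ steps and outputs a set $V_-\subseteq V(G)$ of minimum cardinality such that $G-V_-$ is $\{2K_2,P_3\}$-free. Here algorithms are programs of a unit-cost random access machine with addition, truncated subtraction and comparison as its arithmetic operations (no multiplication). -/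

import Mathlib

open scoped SimpleGraph

/-! ### Graph classes and vertex deletion -/

/-- A class of (simple, undirected) graphs. -/
abbrev GraphClass : Type 1 := ∀ V : Type, SimpleGraph V → Prop

/-- A graph is split if its vertex set is the disjoint union of a clique `C` and an independent
set `I` (either of which may be empty). -/
def IsSplit : GraphClass := fun V G =>
  ∃ C I : Set V, C ∪ I = Set.univ ∧ Disjoint C I ∧ G.IsClique C ∧ G.IsIndepSet I

/-- The graph `2K₂`: two disjoint edges, with nothing between them. -/
def twoK2 : SimpleGraph (Fin 2 ⊕ Fin 2) :=
  (⊤ : SimpleGraph (Fin 2)) ⊕g (⊤ : SimpleGraph (Fin 2))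

/-- A graph is `{2K₂, P₃}`-free if neither `2K₂` nor `P₃`, the path on three vertices, is
isomorphic to an induced subgraph of it. -/
def Is2K2P3Free : GraphClass := fun _ G =>
  ¬ SimpleGraph.IsIndContained twoK2 G ∧ ¬ SimpleGraph.IsIndContained (SimpleGraph.pathGraph 3) G

/-- `G - S`, the subgraph induced by the vertices outside `S`, belongs to the class `𝒞`. -/
def IsDeletionSet (𝒞 : GraphClass) {n : ℕ} (G : SimpleGraph (Fin n)) (S : Finset (Fin n)) : Prop :=
  𝒞 _ (G.induce {v : Fin n | v ∉ S})

/-- `S` is a set of minimum cardinality with `G - S ∈ 𝒞`. -/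
def IsMinDeletionSet (𝒞 : GraphClass) {n : ℕ} (G : SimpleGraph (Fin n))
    (S : Finset (Fin n)) : Prop :=
  IsDeletionSet 𝒞 G S ∧ ∀ T : Finset (Fin n), IsDeletionSet 𝒞 G T → S.card ≤ T.card

/-! ### Random access machines

The model is the unit-cost random access machine with addition, truncated subtraction and
comparison (but no multiplication), programmed by structured commands. In one step a number can at
most double, so that running time is polynomially related to that of a Turing machine. -/

namespace RAM

/-- The contents of the registers, and of the memory banks: `mem b a` is the content of the cell
with address `a` in bank `b`. A program names its registers and its banks explicitly, so it uses
only finitely many of them; cell addresses are computed at run time. -/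
structure State where
  reg : ℕ → ℕ
  mem : ℕ → ℕ → ℕ

/-- `s` with `x` written into register `d`. -/
def State.setReg (s : State) (d x : ℕ) : State :=
  { s with reg := Function.update s.reg d x }

/-- `s` with `x` written into the cell with address `a` in bank `b`. -/
def State.setMem (s : State) (b a x : ℕ) : State :=
  { s with mem := Function.update s.mem b (Function.update (s.mem b) a x) }

/-- Programs. -/
inductive Cmd where
  /-- register `d` becomes the constant `c` -/
  | const (d c : ℕ)
  /-- register `d` becomes the content of register `i` -/
  | copy (d i : ℕ)
  /-- register `d` becomes the sum of registers `i` and `j` -/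
  | add (d i j : ℕ)
  /-- register `d` becomes the truncated difference of registers `i` and `j` -/
  | sub (d i j : ℕ)
  /-- register `d` becomes the content of the cell of bank `b` whose address is in register `i` -/
  | load (d b i : ℕ)
  /-- the cell of bank `b` whose address is in register `i` becomes the content of register `j` -/
  | store (b i j : ℕ)
  /-- first `p`, then `q` -/
  | seq (p q : Cmd)
  /-- `p` if register `i` is smaller than register `j`, and `q` otherwise -/
  | ifLt (i j : ℕ) (p q : Cmd)
  /-- repeat `p` as long as register `i` is smaller than register `j` -/
  | whileLt (i j : ℕ) (p : Cmd)

/-- `Exec p s s' t`: started in state `s`, the program `p` halts in state `s'` after exactly `t`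
steps. Every elementary instruction and every evaluation of a test takes one step. -/
inductive Exec : Cmd → State → State → ℕ → Prop
  | const (s : State) (d c : ℕ) : Exec (.const d c) s (s.setReg d c) 1
  | copy (s : State) (d i : ℕ) : Exec (.copy d i) s (s.setReg d (s.reg i)) 1
  | add (s : State) (d i j : ℕ) : Exec (.add d i j) s (s.setReg d (s.reg i + s.reg j)) 1
  | sub (s : State) (d i j : ℕ) : Exec (.sub d i j) s (s.setReg d (s.reg i - s.reg j)) 1
  | load (s : State) (d b i : ℕ) : Exec (.load d b i) s (s.setReg d (s.mem b (s.reg i))) 1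
  | store (s : State) (b i j : ℕ) : Exec (.store b i j) s (s.setMem b (s.reg i) (s.reg j)) 1
  | seq {p q : Cmd} {s₁ s₂ s₃ : State} {t₁ t₂ : ℕ} :
      Exec p s₁ s₂ t₁ → Exec q s₂ s₃ t₂ → Exec (.seq p q) s₁ s₃ (t₁ + t₂)
  | ifTrue {i j : ℕ} {p q : Cmd} {s s' : State} {t : ℕ} :
      s.reg i < s.reg j → Exec p s s' t → Exec (.ifLt i j p q) s s' (t + 1)
  | ifFalse {i j : ℕ} {p q : Cmd} {s s' : State} {t : ℕ} :
      ¬ s.reg i < s.reg j → Exec q s s' t → Exec (.ifLt i j p q) s s' (t + 1)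
  | whileTrue {i j : ℕ} {p : Cmd} {s₁ s₂ s₃ : State} {t₁ t₂ : ℕ} :
      s₁.reg i < s₁.reg j → Exec p s₁ s₂ t₁ → Exec (.whileLt i j p) s₂ s₃ t₂ →
      Exec (.whileLt i j p) s₁ s₃ (t₁ + t₂ + 1)
  | whileFalse {i j : ℕ} {p : Cmd} {s : State} :
      ¬ s.reg i < s.reg j → Exec (.whileLt i j p) s s 1

open Classical in
/-- The initial state on input `G`: register `0` holds the number `n` of vertices, bank `0` holds
the adjacency matrix row by row (the entry `(u, v)` at address `u * n + v`), and everything else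
is `0`. -/
noncomputable def graphInput {n : ℕ} (G : SimpleGraph (Fin n)) : State where
  reg := fun i => if i = 0 then n else 0
  mem := fun b a =>
    if b = 0 ∧ ∃ u v : Fin n, a = (u : ℕ) * n + (v : ℕ) ∧ G.Adj u v then 1 else 0

/-- The vertex set whose characteristic vector stands in the first `n` cells of bank `1`. -/
def vertexSetOutput (n : ℕ) (s : State) : Finset (Fin n) :=
  Finset.univ.filter fun v => s.mem 1 v ≠ 0

end RAM

/-- The vertex deletion problem `𝒞₁ → 𝒞₂` ("given a graph `G` in `𝒞₁`, find a minimum set `S` of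
vertices such that `G - S` is in `𝒞₂`") is solvable in polynomial time: one program halts on every
graph `G` in `𝒞₁`, after a number of steps that is bounded by a polynomial in the number of
vertices, with a minimum solution as its output. The input consists of `G` alone. -/
def VertexDeletionInP (𝒞₁ 𝒞₂ : GraphClass) : Prop :=
  ∃ (prog : RAM.Cmd) (p : Polynomial ℕ), ∀ (n : ℕ) (G : SimpleGraph (Fin n)), 𝒞₁ (Fin n) G →
    ∃ (s : RAM.State) (t : ℕ), RAM.Exec prog (RAM.graphInput G) s t ∧ t ≤ p.eval n ∧
      IsMinDeletionSet 𝒞₂ G (RAM.vertexSetOutput n s)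

/-! ### A language of bounded loops, compiled to random access machines -/

namespace RAM

/-! Fix a split partition into a clique `C` and an independent set. A split graph contains no
induced `2K₂`, so only `P₃` has to be destroyed, that is, adjacency must become transitive
(`isDeletionSet_iff`). Suppose that a deletion set leaves an edge from some `i` outside `C` to a
vertex of `C`. Transitivity then makes every surviving vertex of `C` adjacent to `i`, and no other
survivor outside `C` can keep a neighbour in `C`. If no such edge is left, any vertex of `C` can
play the role of `i`. Hence every solution has a centre `y`: it contains the vertices of `C` outside
the closed neighbourhood of `y`, and it covers the bipartite graph between the rest of `C` and the
vertices other than `y` outside `C` (`exists_centre`). Conversely, the forced vertices together with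
a vertex cover given by a price level form a solution (`transitiveOutside_candidate`). It remains to
find a minimum vertex cover of a bipartite graph for each `y`.

The cover comes from an auction. Buyers without an item bid for their cheapest neighbour, raising
its price by one and dispossessing its owner. At most about `n * n` bids occur, since prices stay at
most `n`. When bidding stops, the sold items and their owners form a matching. At a level `l` with
no price equal to `l + 1`, the items dearer than `l` and the buyers with a neighbour of price at
most `l` form a cover that injects into this matching, so it is minimum, as in König's theorem
(`IsAuction.exists_level`).

The partition is not part of the input, but one suitable clique consists of the vertices of degree
at least `k` plus one vertex `u` (`exists_degreeCore`). The program tries all `k`, `u`, `y` and `l`,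
tests each candidate for transitivity, and keeps the best. Wrong guesses are therefore harmless, and
the right one attains the minimum. The program is written in a language of loops of length `n`,
whose compilation to the machine is proved correct with a polynomial time bound
(`Stmt.exec_compile`). -/

/-- Arithmetic expressions over variables and memory banks, with sums over `0, …, n - 1`. -/
inductive Expr where
  | lit (c : ℕ)
  | var (v : ℕ)
  | add (a b : Expr)
  | sub (a b : Expr)
  | load (b : ℕ) (a : Expr)
  | sum (v : ℕ) (e : Expr)

/-- Statements: assignments, writes to memory, conditionals and loops over `0, …, n - 1`. -/
inductive Stmt where
  | assign (v : ℕ) (e : Expr)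
  | store (b : ℕ) (a e : Expr)
  | seq (p q : Stmt)
  | ite (e : Expr) (p : Stmt)
  | loop (v : ℕ) (p : Stmt)

variable {n : ℕ}

/-- The value of an expression, where variable `v` has the value `σ.reg v`. -/
def Expr.eval (n : ℕ) : Expr → State → ℕ
  | lit c, _ => c
  | var v, σ => σ.reg v
  | add a b, σ => a.eval n σ + b.eval n σ
  | sub a b, σ => a.eval n σ - b.eval n σ
  | load b a, σ => σ.mem b (a.eval n σ)
  | sum v e, σ => ∑ k ∈ Finset.range n, e.eval n (σ.setReg v k)

/-- The effect of a loop: run `f` once for each value `0, …, k - 1` of the variable `v`. -/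
def iter (f : State → State) (v : ℕ) : ℕ → State → State
  | 0, σ => σ
  | k + 1, σ => f ((iter f v k σ).setReg v k)

/-- The effect of a statement. -/
def Stmt.run (n : ℕ) : Stmt → State → State
  | assign v e, σ => σ.setReg v (e.eval n σ)
  | store b a e, σ => σ.setMem b (a.eval n σ) (e.eval n σ)
  | seq p q, σ => q.run n (p.run n σ)
  | ite e p, σ => if 0 < e.eval n σ then p.run n σ else σ
  | loop v p, σ => iter (p.run n) v n σ

/-- The program that writes the value of an expression into scratch register `d`. Variable `v` is
kept in register `2 * v + 2`, and scratch register `d` is register `2 * d + 1`. -/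
def Expr.compile : Expr → ℕ → Cmd
  | lit c, d => .const (2 * d + 1) c
  | var v, d => .copy (2 * d + 1) (2 * v + 2)
  | add a b, d =>
    .seq (a.compile d) (.seq (b.compile (d + 1)) (.add (2 * d + 1) (2 * d + 1) (2 * (d + 1) + 1)))
  | sub a b, d =>
    .seq (a.compile d) (.seq (b.compile (d + 1)) (.sub (2 * d + 1) (2 * d + 1) (2 * (d + 1) + 1)))
  | load b a, d => .seq (a.compile d) (.load (2 * d + 1) b (2 * d + 1))
  | sum v e, d =>
    .seq (.const (2 * d + 1) 0) <| .seq (.const (2 * (d + 1) + 1) 0) <|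
    .seq (.copy (2 * (d + 2) + 1) (2 * v + 2)) <| .seq (.const (2 * (d + 3) + 1) 1) <|
    .seq (.whileLt (2 * (d + 1) + 1) 0 <|
      .seq (.copy (2 * v + 2) (2 * (d + 1) + 1)) <| .seq (e.compile (d + 4)) <|
      .seq (.add (2 * d + 1) (2 * d + 1) (2 * (d + 4) + 1))
        (.add (2 * (d + 1) + 1) (2 * (d + 1) + 1) (2 * (d + 3) + 1)))
    (.copy (2 * v + 2) (2 * (d + 2) + 1))

/-- The program for a statement, using scratch registers from `d` on. -/
def Stmt.compile : Stmt → ℕ → Cmd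
  | assign v e, d => .seq (e.compile d) (.copy (2 * v + 2) (2 * d + 1))
  | store b a e, d =>
    .seq (a.compile d) (.seq (e.compile (d + 1)) (.store b (2 * d + 1) (2 * (d + 1) + 1)))
  | seq p q, d => .seq (p.compile d) (q.compile d)
  | ite e p, d =>
    .seq (e.compile d) <| .seq (.const (2 * (d + 1) + 1) 0) <|
    .ifLt (2 * (d + 1) + 1) (2 * d + 1) (p.compile d) (.const (2 * d + 1) 0)
  | loop v p, d =>
    .seq (.const (2 * d + 1) 0) <| .seq (.const (2 * (d + 1) + 1) 1) <|
    .whileLt (2 * d + 1) 0 <| .seq (.copy (2 * v + 2) (2 * d + 1)) <|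
    .seq (p.compile (d + 2)) (.add (2 * d + 1) (2 * d + 1) (2 * (d + 1) + 1))

/-- A bound on the running time of `Expr.compile`. -/
noncomputable def Expr.time : Expr → Polynomial ℕ
  | lit _ => 1
  | var _ => 1
  | add a b => a.time + (b.time + 1)
  | sub a b => a.time + (b.time + 1)
  | load _ a => a.time + 1
  | sum _ e => Polynomial.X * (e.time + 4) + 6

/-- A bound on the running time of `Stmt.compile`. -/
noncomputable def Stmt.time : Stmt → Polynomial ℕ
  | assign _ e => e.time + 1
  | store _ a e => a.time + (e.time + 1)
  | seq p q => p.time + q.time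
  | ite e p => e.time + (p.time + 3)
  | loop _ p => Polynomial.X * (p.time + 3) + 3

/-! ### Correctness and running time of the compilation. -/

/-- The machine state `s` represents the state `σ` of the variables and the memory. -/
structure Represents (n : ℕ) (s σ : State) : Prop where
  size : s.reg 0 = n
  var (v : ℕ) : s.reg (2 * v + 2) = σ.reg v
  mem : s.mem = σ.mem

@[simp] theorem State.reg_setReg (s : State) (d x i : ℕ) :
    (s.setReg d x).reg i = if i = d then x else s.reg i := by
  simp [State.setReg, Function.update_apply]

@[simp] theorem State.mem_setReg (s : State) (d x : ℕ) : (s.setReg d x).mem = s.mem := rfl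

@[simp] theorem State.reg_setMem (s : State) (b a x : ℕ) : (s.setMem b a x).reg = s.reg := rfl

theorem State.mem_setMem (s : State) (b a x c i : ℕ) :
    (s.setMem b a x).mem c i = if c = b ∧ i = a then x else s.mem c i := by
  by_cases h : c = b
  · subst h; simp [State.setMem, Function.update_apply]
  · simp [State.setMem, h]

theorem Represents.setScratch {s σ : State} (h : Represents n s σ) (d x : ℕ) :
    Represents n (s.setReg (2 * d + 1) x) σ where
  size := by simpa using h.size
  var v := by
    rw [State.reg_setReg, if_neg (by omega)]
    exact h.var v
  mem := h.mem

theorem Represents.setVar {s σ : State} (h : Represents n s σ) (v x : ℕ) :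
    Represents n (s.setReg (2 * v + 2) x) (σ.setReg v x) where
  size := by simpa using h.size
  var w := by simp [h.var w]
  mem := h.mem

/-- `Exec` unrolls a loop from its first iteration, so the induction is on the number `m` of
iterations that remain. Each iteration pays `T` for the body and one for the test; the last `1` is
the failing test. -/
theorem exec_whileLt {c : ℕ} {p : Cmd} {T : ℕ} (Inv : ℕ → State → Prop)
    (hreg : ∀ k s, Inv k s → s.reg c = k ∧ s.reg 0 = n)
    (hstep : ∀ k < n, ∀ s, Inv k s → ∃ s' t, Exec p s s' t ∧ t ≤ T ∧ Inv (k + 1) s')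
    {s : State} (hs : Inv 0 s) :
    ∃ s' t, Exec (.whileLt c 0 p) s s' t ∧ t ≤ n * (T + 1) + 1 ∧ Inv n s' := by
  suffices H : ∀ m ≤ n, ∀ s, Inv (n - m) s →
      ∃ s' t, Exec (.whileLt c 0 p) s s' t ∧ t ≤ m * (T + 1) + 1 ∧ Inv n s' from
    H n le_rfl s (by simpa using hs)
  intro m
  induction m with
  | zero =>
    intro _ s hs
    obtain ⟨h1, h2⟩ := hreg _ _ hs
    exact ⟨s, 1, .whileFalse (by omega), by omega, by simpa using hs⟩
  | succ m ih =>
    intro hm s hs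
    obtain ⟨h1, h2⟩ := hreg _ _ hs
    obtain ⟨s₁, t₁, e₁, ht₁, i₁⟩ := hstep _ (by omega) s hs
    obtain ⟨s₂, t₂, e₂, ht₂, i₂⟩ := ih (by omega) s₁ (by
      rwa [show n - m = n - (m + 1) + 1 by omega])
    refine ⟨s₂, _, .whileTrue (by omega) e₁ e₂, ?_, i₂⟩
    rw [add_mul]
    omega

theorem Expr.exec_compile (e : Expr) : ∀ (d : ℕ) (s σ : State), Represents n s σ →
    ∃ s' t, Exec (e.compile d) s s' t ∧ t ≤ e.time.eval n ∧ Represents n s' σ ∧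
      s'.reg (2 * d + 1) = e.eval n σ ∧ ∀ i < d, s'.reg (2 * i + 1) = s.reg (2 * i + 1) := by
  induction e with
  | lit c =>
    intro d s σ h
    refine ⟨_, _, .const .., by simp [time], h.setScratch .., by simp [eval], fun i hi => ?_⟩
    rw [State.reg_setReg, if_neg (by omega)]
  | var v =>
    intro d s σ h
    refine ⟨_, _, .copy .., by simp [time], h.setScratch .., by simp [eval, h.var],
      fun i hi => ?_⟩
    rw [State.reg_setReg, if_neg (by omega)]
  | add a b iha ihb =>
    intro d s σ h
    obtain ⟨s₁, t₁, e₁, ht₁, h₁, v₁, f₁⟩ := iha d s σ h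
    obtain ⟨s₂, t₂, e₂, ht₂, h₂, v₂, f₂⟩ := ihb (d + 1) s₁ σ h₁
    refine ⟨_, _, .seq e₁ (.seq e₂ (.add ..)), by simp [time]; omega, h₂.setScratch ..,
      by simp [eval, v₂, f₂ d (by omega), v₁], fun i hi => ?_⟩
    rw [State.reg_setReg, if_neg (by omega), f₂ i (by omega), f₁ i hi]
  | sub a b iha ihb =>
    intro d s σ h
    obtain ⟨s₁, t₁, e₁, ht₁, h₁, v₁, f₁⟩ := iha d s σ h
    obtain ⟨s₂, t₂, e₂, ht₂, h₂, v₂, f₂⟩ := ihb (d + 1) s₁ σ h₁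
    refine ⟨_, _, .seq e₁ (.seq e₂ (.sub ..)), by simp [time]; omega, h₂.setScratch ..,
      by simp [eval, v₂, f₂ d (by omega), v₁], fun i hi => ?_⟩
    rw [State.reg_setReg, if_neg (by omega), f₂ i (by omega), f₁ i hi]
  | load b a iha =>
    intro d s σ h
    obtain ⟨s₁, t₁, e₁, ht₁, h₁, v₁, f₁⟩ := iha d s σ h
    refine ⟨_, _, .seq e₁ (.load ..), by simp [time]; omega, h₁.setScratch ..,
      by simp [eval, v₁, h₁.mem], fun i hi => ?_⟩
    rw [State.reg_setReg, if_neg (by omega), f₁ i hi]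
  | sum v e ih =>
    intro d s σ h
    -- Scratch registers `d` to `d + 3` hold the partial sum, the counter, the saved value of `v`
    -- and the constant `1`. The invariant leaves the current value `x` of `v` open, because the
    -- loop clobbers it; the final copy restores it.
    obtain ⟨s₁, t₁, e₁, ht₁, ⟨x, h₁⟩, a₁, -, c₁, -, f₁⟩ := exec_whileLt (n := n)
      (c := 2 * (d + 1) + 1) (T := e.time.eval n + 3)
      (p := .seq (.copy (2 * v + 2) (2 * (d + 1) + 1)) <| .seq (e.compile (d + 4)) <|
        .seq (.add (2 * d + 1) (2 * d + 1) (2 * (d + 4) + 1))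
          (.add (2 * (d + 1) + 1) (2 * (d + 1) + 1) (2 * (d + 3) + 1)))
      (fun k τ => (∃ x, Represents n τ (σ.setReg v x)) ∧
        τ.reg (2 * d + 1) = ∑ j ∈ Finset.range k, e.eval n (σ.setReg v j) ∧
        τ.reg (2 * (d + 1) + 1) = k ∧ τ.reg (2 * (d + 2) + 1) = σ.reg v ∧
        τ.reg (2 * (d + 3) + 1) = 1 ∧ ∀ i < d, τ.reg (2 * i + 1) = s.reg (2 * i + 1))
      (fun k τ hτ => ⟨hτ.2.2.1, hτ.1.choose_spec.size⟩)
      (by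
        rintro k hk τ ⟨⟨x, r⟩, ha, hc, hs, ho, hf⟩
        have r' : Represents n (τ.setReg (2 * v + 2) (τ.reg (2 * (d + 1) + 1))) (σ.setReg v k) := by
          have := r.setVar v k
          rw [hc]
          refine ⟨this.size, fun w => ?_, this.mem⟩
          rw [this.var]
          simp only [State.reg_setReg]
          split_ifs <;> rfl
        obtain ⟨τ₁, t₁, e₁, ht₁, r₁, v₁, f₁⟩ := ih (d + 4) _ _ r'
        have g : ∀ i < d + 4, τ₁.reg (2 * i + 1) = τ.reg (2 * i + 1) := fun i hi => by
          rw [f₁ i hi, State.reg_setReg, if_neg (by omega)]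
        refine ⟨_, _, .seq (.copy ..) (.seq e₁ (.seq (.add ..) (.add ..))), by omega,
          ⟨k, (r₁.setScratch ..).setScratch ..⟩, ?_, ?_, ?_, ?_, fun i hi => ?_⟩
        · simp [v₁, g d (by omega), ha, Finset.sum_range_succ]
        · simp [g (d + 1) (by omega), g (d + 3) (by omega), hc, ho]
        · simp [g (d + 2) (by omega), hs]
        · simp [g (d + 3) (by omega), ho]
        · rw [State.reg_setReg, if_neg (by omega), State.reg_setReg, if_neg (by omega),
            g i (by omega), hf i hi])
      (s := (((s.setReg (2 * d + 1) 0).setReg (2 * (d + 1) + 1) 0).setReg (2 * (d + 2) + 1)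
        (((s.setReg (2 * d + 1) 0).setReg (2 * (d + 1) + 1) 0).reg (2 * v + 2))).setReg
          (2 * (d + 3) + 1) 1)
      (by
        refine ⟨⟨σ.reg v, ?_⟩, by simp, by simp, ?_, by simp, fun i hi => ?_⟩
        · have := (((h.setScratch d 0).setScratch (d + 1) 0).setScratch (d + 2)
            (((s.setReg (2 * d + 1) 0).setReg (2 * (d + 1) + 1) 0).reg (2 * v + 2))).setScratch
            (d + 3) 1
          refine ⟨this.size, fun w => ?_, this.mem⟩
          rw [this.var, State.reg_setReg]
          split_ifs with hw
          · rw [hw]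
          · rfl
        · rw [State.reg_setReg, if_neg (by omega), State.reg_setReg, if_pos rfl,
            ((h.setScratch d 0).setScratch (d + 1) 0).var]
        · iterate 4 rw [State.reg_setReg, if_neg (by omega)])
    refine ⟨_, _, .seq (.const ..) (.seq (.const ..) (.seq (.copy ..) (.seq (.const ..)
      (.seq e₁ (.copy ..))))), ?_, ?_, ?_, fun i hi => ?_⟩
    · simp only [time, Polynomial.eval_add, Polynomial.eval_mul, Polynomial.eval_X,
        Polynomial.eval_ofNat]
      have : e.time.eval n + 3 + 1 = e.time.eval n + 4 := rfl
      rw [this] at ht₁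
      omega
    · rw [c₁]
      have := h₁.setVar v (σ.reg v)
      refine ⟨this.size, fun w => ?_, this.mem⟩
      rw [this.var]
      simp only [State.reg_setReg]
      split_ifs with hw
      · rw [hw]
      · rfl
    · rw [State.reg_setReg, if_neg (by omega), a₁, eval]
    · rw [State.reg_setReg, if_neg (by omega), f₁ i hi]

theorem Stmt.exec_compile (p : Stmt) : ∀ (d : ℕ) (s σ : State), Represents n s σ →
    ∃ s' t, Exec (p.compile d) s s' t ∧ t ≤ p.time.eval n ∧ Represents n s' (p.run n σ) ∧
      ∀ i < d, s'.reg (2 * i + 1) = s.reg (2 * i + 1) := by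
  induction p with
  | assign v e =>
    intro d s σ h
    obtain ⟨s₁, t₁, e₁, ht₁, h₁, v₁, f₁⟩ := e.exec_compile d s σ h
    refine ⟨_, _, .seq e₁ (.copy ..), by simp [time]; omega, ?_, fun i hi => ?_⟩
    · rw [v₁]; exact h₁.setVar ..
    · rw [State.reg_setReg, if_neg (by omega), f₁ i hi]
  | store b a e =>
    intro d s σ h
    obtain ⟨s₁, t₁, e₁, ht₁, h₁, v₁, f₁⟩ := a.exec_compile d s σ h
    obtain ⟨s₂, t₂, e₂, ht₂, h₂, v₂, f₂⟩ := e.exec_compile (d + 1) s₁ σ h₁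
    refine ⟨_, _, .seq e₁ (.seq e₂ (.store ..)), by simp [time]; omega, ?_, fun i hi => ?_⟩
    · rw [v₂, f₂ d (by omega), v₁]
      exact ⟨h₂.size, h₂.var, by simp [State.setMem, run, h₂.mem]⟩
    · rw [State.reg_setMem, f₂ i (by omega), f₁ i hi]
  | seq p q ihp ihq =>
    intro d s σ h
    obtain ⟨s₁, t₁, e₁, ht₁, h₁, f₁⟩ := ihp d s σ h
    obtain ⟨s₂, t₂, e₂, ht₂, h₂, f₂⟩ := ihq d s₁ _ h₁
    exact ⟨_, _, .seq e₁ e₂, by simp [time]; omega, h₂, fun i hi => by rw [f₂ i hi, f₁ i hi]⟩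
  | ite e p ih =>
    intro d s σ h
    obtain ⟨s₁, t₁, e₁, ht₁, h₁, v₁, f₁⟩ := e.exec_compile d s σ h
    have h₂ := h₁.setScratch (d + 1) 0
    have c : (s₁.setReg (2 * (d + 1) + 1) 0).reg (2 * (d + 1) + 1) <
        (s₁.setReg (2 * (d + 1) + 1) 0).reg (2 * d + 1) ↔ 0 < e.eval n σ := by
      simp [v₁]
    have g : ∀ i < d, (s₁.setReg (2 * (d + 1) + 1) 0).reg (2 * i + 1) = s.reg (2 * i + 1) :=
      fun i hi => by rw [State.reg_setReg, if_neg (by omega), f₁ i hi]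
    by_cases he : 0 < e.eval n σ
    · obtain ⟨s₂, t₂, e₂, ht₂, h₃, f₂⟩ := ih d _ _ h₂
      refine ⟨_, _, .seq e₁ (.seq (.const ..) (.ifTrue (c.2 he) e₂)), by simp [time]; omega,
        by simpa [run, he] using h₃, fun i hi => by rw [f₂ i hi, g i hi]⟩
    · refine ⟨_, _, .seq e₁ (.seq (.const ..) (.ifFalse (mt c.1 he) (.const ..))),
        by simp [time]; omega, by simpa [run, he] using h₂.setScratch d 0, fun i hi => ?_⟩
      rw [State.reg_setReg, if_neg (by omega), g i hi]
  | loop v p ih =>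
    intro d s σ h
    obtain ⟨s₁, t₁, e₁, ht₁, h₁, -, -, f₁⟩ := exec_whileLt (n := n)
      (c := 2 * d + 1) (T := p.time.eval n + 2)
      (p := .seq (.copy (2 * v + 2) (2 * d + 1)) <|
        .seq (p.compile (d + 2)) (.add (2 * d + 1) (2 * d + 1) (2 * (d + 1) + 1)))
      (fun k τ => Represents n τ (iter (p.run n) v k σ) ∧ τ.reg (2 * d + 1) = k ∧
        τ.reg (2 * (d + 1) + 1) = 1 ∧ ∀ i < d, τ.reg (2 * i + 1) = s.reg (2 * i + 1))
      (fun k τ hτ => ⟨hτ.2.1, hτ.1.size⟩)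
      (by
        rintro k hk τ ⟨r, hc, ho, hf⟩
        have r' := r.setVar v (τ.reg (2 * d + 1))
        obtain ⟨τ₁, t₁, e₁, ht₁, r₁, f₁⟩ := ih (d + 2) _ _ r'
        have g : ∀ i < d + 2, τ₁.reg (2 * i + 1) = τ.reg (2 * i + 1) := fun i hi => by
          rw [f₁ i hi, State.reg_setReg, if_neg (by omega)]
        refine ⟨_, _, .seq (.copy ..) (.seq e₁ (.add ..)), by omega, ?_, ?_, ?_, fun i hi => ?_⟩
        · rw [hc] at r₁
          exact r₁.setScratch ..
        · simp [g d (by omega), g (d + 1) (by omega), hc, ho]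
        · simp [g (d + 1) (by omega), ho]
        · rw [State.reg_setReg, if_neg (by omega), g i (by omega), hf i hi])
      (s := (s.setReg (2 * d + 1) 0).setReg (2 * (d + 1) + 1) 1)
      (by
        refine ⟨(h.setScratch d 0).setScratch (d + 1) 1, by simp, by simp, fun i hi => ?_⟩
        iterate 2 rw [State.reg_setReg, if_neg (by omega)])
    refine ⟨_, _, .seq (.const ..) (.seq (.const ..) e₁), ?_, h₁, f₁⟩
    simp only [time, Polynomial.eval_add, Polynomial.eval_mul, Polynomial.eval_X,
      Polynomial.eval_ofNat]
    have : p.time.eval n + 2 + 1 = p.time.eval n + 3 := rfl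
    rw [this] at ht₁
    omega

/-! ### Frame properties and rules for loops. -/

/-- The statement may write to variable `v`. -/
def Stmt.WritesVar (v : ℕ) : Stmt → Prop
  | assign w _ => v = w
  | store .. => False
  | seq p q => p.WritesVar v ∨ q.WritesVar v
  | ite _ p => p.WritesVar v
  | loop w p => v = w ∨ p.WritesVar v

/-- The statement may write to bank `b`. -/
def Stmt.WritesBank (b : ℕ) : Stmt → Prop
  | assign .. => False
  | store c _ _ => b = c
  | seq p q => p.WritesBank b ∨ q.WritesBank b
  | ite _ p => p.WritesBank b
  | loop _ p => p.WritesBank b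

theorem Stmt.run_loop_induction {v : ℕ} {p : Stmt} {σ : State} (Inv : ℕ → State → Prop)
    (h0 : Inv 0 σ) (hstep : ∀ k < n, ∀ τ, Inv k τ → Inv (k + 1) (p.run n (τ.setReg v k))) :
    Inv n ((loop v p).run n σ) := by
  suffices H : ∀ k ≤ n, Inv k (iter (p.run n) v k σ) from H n le_rfl
  intro k
  induction k with
  | zero => exact fun _ => h0
  | succ k ih => exact fun hk => hstep k hk _ (ih (by omega))

theorem Stmt.reg_run {v : ℕ} {p : Stmt} (h : ¬ p.WritesVar v) (σ : State) :
    (p.run n σ).reg v = σ.reg v := by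
  induction p generalizing σ with
  | assign w e => simpa [run, WritesVar] using fun hw => absurd hw h
  | store b a e => simp [run]
  | seq p q ihp ihq =>
    simp only [WritesVar, not_or] at h
    rw [run, ihq h.2, ihp h.1]
  | ite e p ih =>
    rw [run]
    split_ifs
    · exact ih h σ
    · rfl
  | loop w p ih =>
    simp only [WritesVar, not_or] at h
    exact run_loop_induction (fun _ τ => τ.reg v = σ.reg v) rfl fun k _ τ hτ => by
      rw [ih h.2, State.reg_setReg, if_neg h.1, hτ]

theorem Stmt.mem_run {b : ℕ} {p : Stmt} (h : ¬ p.WritesBank b) (σ : State) :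
    (p.run n σ).mem b = σ.mem b := by
  induction p generalizing σ with
  | assign w e => simp [run]
  | store c a e =>
    funext i
    simp only [WritesBank] at h
    rw [run, State.mem_setMem, if_neg (by tauto)]
  | seq p q ihp ihq =>
    simp only [WritesBank, not_or] at h
    rw [run, ihq h.2, ihp h.1]
  | ite e p ih =>
    rw [run]
    split_ifs
    · exact ih h σ
    · rfl
  | loop w p ih =>
    exact run_loop_induction (fun _ τ => τ.mem b = σ.mem b) rfl fun k _ τ hτ => by
      rw [ih h, State.mem_setReg, hτ]

/-- If one iteration of a loop establishes `J` and the others preserve it, so does the loop. -/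
theorem Stmt.run_loop_of_hit {v : ℕ} {p : Stmt} {σ : State} {I J : State → Prop} (k₀ : Fin n)
    (hI : ∀ k : Fin n, ∀ τ, I τ → I (p.run n (τ.setReg v k)))
    (hJ : ∀ k : Fin n, ∀ τ, J τ → J (p.run n (τ.setReg v k)))
    (hit : ∀ τ, I τ → J (p.run n (τ.setReg v k₀))) (h : I σ) : J ((loop v p).run n σ) := by
  have := run_loop_induction (n := n) (v := v) (p := p) (σ := σ)
    -- Here `k` counts completed iterations, so iteration `k₀` is over exactly when `k₀ < k`.
    (fun k τ => if (k₀ : ℕ) < k then J τ else I τ) (by simpa using h) (by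
      intro k hk τ hτ
      rcases lt_trichotomy (k₀ : ℕ) k with hlt | heq | hgt
      · rw [if_pos hlt] at hτ
        rw [if_pos (by omega)]
        exact hJ ⟨k, hk⟩ τ hτ
      · rw [if_neg (by omega)] at hτ
        rw [if_pos (by omega), ← heq]
        exact hit τ hτ
      · rw [if_neg (by omega)] at hτ
        rw [if_neg (by omega)]
        exact hI ⟨k, hk⟩ τ hτ)
  simpa using this

theorem represents_graphInput (G : SimpleGraph (Fin n)) :
    Represents n (graphInput G) { graphInput G with reg := fun _ => 0 } where
  size := by simp [graphInput]
  var v := by simp [graphInput]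
  mem := rfl

/-! ### Conditions as expressions -/

/-- An expression is read as a condition: it holds if its value is positive. -/
def Expr.Holds (n : ℕ) (e : Expr) (σ : State) : Prop := 0 < e.eval n σ

namespace Expr

def not (e : Expr) : Expr := .sub (.lit 1) e
def and (a b : Expr) : Expr := not (.add (not a) (not b))
def or (a b : Expr) : Expr := .add a b
def lt (a b : Expr) : Expr := .sub b a
def le (a b : Expr) : Expr := not (lt b a)
def eq (a b : Expr) : Expr := and (le a b) (le b a)
def ex (v : ℕ) (e : Expr) : Expr := .sum v e
def all (v : ℕ) (e : Expr) : Expr := not (ex v (not e))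
-- A condition may take any positive value; the double negation normalises it to `0` or `1` before
-- summation.
def count (v : ℕ) (e : Expr) : Expr := .sum v (not (not e))
-- Register `0`, which holds `n`, is not a variable of the language, so `n` is recovered as a sum of
-- ones.
def size : Expr := .sum 0 (.lit 1)

@[simp] theorem holds_not (e : Expr) (σ : State) : (not e).Holds n σ ↔ ¬ e.Holds n σ := by
  simp only [Holds, not, eval]; omega

@[simp] theorem holds_and (a b : Expr) (σ : State) :
    (and a b).Holds n σ ↔ a.Holds n σ ∧ b.Holds n σ := by
  simp only [Holds, and, not, eval]; omega

@[simp] theorem holds_or (a b : Expr) (σ : State) :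
    (or a b).Holds n σ ↔ a.Holds n σ ∨ b.Holds n σ := by
  simp only [Holds, or, eval]; omega

@[simp] theorem holds_lt (a b : Expr) (σ : State) :
    (lt a b).Holds n σ ↔ a.eval n σ < b.eval n σ := by
  simp only [Holds, lt, eval]; omega

@[simp] theorem holds_le (a b : Expr) (σ : State) :
    (le a b).Holds n σ ↔ a.eval n σ ≤ b.eval n σ := by
  simp [le]

@[simp] theorem holds_eq (a b : Expr) (σ : State) :
    (eq a b).Holds n σ ↔ a.eval n σ = b.eval n σ := by
  simp only [eq, holds_and, holds_le]; omega

@[simp] theorem holds_ex (v : ℕ) (e : Expr) (σ : State) :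
    (ex v e).Holds n σ ↔ ∃ k : Fin n, e.Holds n (σ.setReg v k) := by
  simp [Holds, ex, eval, Nat.pos_iff_ne_zero, Finset.sum_eq_zero_iff, Fin.exists_iff]

@[simp] theorem holds_all (v : ℕ) (e : Expr) (σ : State) :
    (all v e).Holds n σ ↔ ∀ k : Fin n, e.Holds n (σ.setReg v k) := by
  simp [all]

open Classical in
@[simp] theorem eval_count (v : ℕ) (e : Expr) (σ : State) :
    (count v e).eval n σ = (Finset.univ.filter fun k : Fin n => e.Holds n (σ.setReg v k)).card := by
  rw [count, eval, Finset.sum_range, Finset.card_filter]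
  refine Finset.sum_congr rfl fun k _ => ?_
  by_cases h : e.Holds n (σ.setReg v k)
  · rw [if_pos h]
    simp only [not, eval, Holds] at h ⊢
    omega
  · rw [if_neg h]
    simp only [not, eval, Holds] at h ⊢
    omega

@[simp] theorem eval_size (σ : State) : size.eval n σ = n := by
  simp [size, eval]

end Expr

end RAM

/-! ### Minimum vertex covers of bipartite graphs by an auction -/

section Auction

variable {n : ℕ}

/-- The buyer `v` owns nothing and bids for its cheapest neighbour `w`, where `p` gives the prices
and `o w = v + 1` says that `v` owns `w`. -/
def Bids (E : Fin n → Fin n → Prop) (p o : Fin n → ℕ) (v w : Fin n) : Prop :=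
  E v w ∧ p w < n ∧ (∀ x, E v x → p w ≤ p x) ∧ ∀ x, o x ≠ v + 1

/-- The invariants of the auction. -/
structure IsAuction (E : Fin n → Fin n → Prop) (p o : Fin n → ℕ) : Prop where
  owned {w} : 0 < p w → o w ≠ 0
  owner {w} : o w ≠ 0 → ∃ v : Fin n, o w = v + 1
  edge {v w : Fin n} : o w = v + 1 → E v w
  tight {v w x : Fin n} : o w = v + 1 → E v x → p w ≤ p x + 1
  inj {w x : Fin n} : o w = o x → o w ≠ 0 → w = x
  le (w) : p w ≤ n

theorem isAuction_zero (E : Fin n → Fin n → Prop) : IsAuction E (fun _ => 0) (fun _ => 0) where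
  owned h := absurd h (lt_irrefl 0)
  owner h := absurd rfl h
  edge h := absurd h (by omega)
  tight h := absurd h (by omega)
  inj _ h := absurd rfl h
  le _ := Nat.zero_le n

/-- Tightness holds for the new owner because `w` was its cheapest neighbour, and for the other
owners because their own prices stay put while no price falls. Ownership stays injective because the
bidder owned nothing. -/
theorem IsAuction.bid {E : Fin n → Fin n → Prop} {p o : Fin n → ℕ} (h : IsAuction E p o)
    {v w : Fin n} (hb : Bids E p o v w) :
    IsAuction E (Function.update p w (p w + 1)) (Function.update o w (v + 1)) := by
  obtain ⟨he, hlt, hmin, hfree⟩ := hb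
  have hmono : ∀ x, p x ≤ Function.update p w (p w + 1) x := fun x => by
    rw [Function.update_apply]
    split_ifs with hx
    · rw [hx]; omega
    · rfl
  refine ⟨?_, ?_, ?_, ?_, ?_, ?_⟩
  · intro x hx
    by_cases hxw : x = w
    · simp [hxw]
    · simp only [Function.update_apply, if_neg hxw] at hx ⊢
      exact h.owned hx
  · intro x hx
    by_cases hxw : x = w
    · exact ⟨v, by simp [hxw]⟩
    · simp only [Function.update_apply, if_neg hxw] at hx ⊢
      exact h.owner hx
  · intro a x hx
    by_cases hxw : x = w
    · subst hxw
      simp only [Function.update_self, Nat.add_right_cancel_iff] at hx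
      rwa [← Fin.ext hx]
    · simp only [Function.update_apply, if_neg hxw] at hx
      exact h.edge hx
  · intro a x z hx hz
    refine le_trans ?_ (Nat.add_le_add_right (hmono z) 1)
    by_cases hxw : x = w
    · subst hxw
      simp only [Function.update_self, Nat.add_right_cancel_iff] at hx
      rw [Function.update_self]
      exact Nat.add_le_add_right (hmin z (by rwa [Fin.ext hx])) 1
    · simp only [Function.update_apply, if_neg hxw] at hx ⊢
      exact h.tight hx hz
  · intro x z hxz hx
    by_cases hxw : x = w <;> by_cases hzw : z = w
    · rw [hxw, hzw]
    · simp only [Function.update_apply, if_pos hxw, if_neg hzw] at hxz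
      exact absurd hxz.symm (hfree z)
    · simp only [Function.update_apply, if_neg hxw, if_pos hzw] at hxz
      exact absurd hxz (hfree x)
    · simp only [Function.update_apply, if_neg hxw, if_neg hzw] at hxz hx
      exact h.inj hxz hx
  · intro x
    rw [Function.update_apply]
    split_ifs
    · exact hlt
    · exact h.le x

open Classical in
/-- When nobody bids any more, some price level separates a vertex cover of minimum size. -/
theorem IsAuction.exists_level {E : Fin n → Fin n → Prop} {p o : Fin n → ℕ} (h : IsAuction E p o)
    (hstable : ∀ v w, ¬ Bids E p o v w) {u : Fin n} (hu : ∀ v, ¬ E v u)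
    (hdisj : ∀ v w x, E v w → ¬ E w x) {D T : Finset (Fin n)}
    (hcover : ∀ v w, E v w → v ∈ T ∨ w ∈ T) (hDT : D ⊆ T)
    (hD : ∀ v w, E v w → v ∉ D ∧ w ∉ D) :
    ∃ l : Fin n, (D ∪ (Finset.univ.filter (fun v => ∃ w, E v w ∧ p w ≤ l) ∪
      Finset.univ.filter fun w => (l : ℕ) < p w)).card ≤ T.card := by
  -- Pigeonhole: if all `n` values `1, …, n` were prices, every item would have a positive price and
  -- hence an owner, but `u` is nobody's neighbour.
  obtain ⟨l, hl⟩ : ∃ l : Fin n, ∀ w, p w ≠ l + 1 := by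
    by_contra! hcon
    choose f hf using hcon
    have hinj : Function.Injective f := fun a b hab => by
      have ha := hf a
      rw [hab, hf b] at ha
      exact Fin.ext (by omega)
    obtain ⟨l, rfl⟩ := Finite.surjective_of_injective hinj u
    obtain ⟨v, hv⟩ := h.owner (h.owned (by rw [hf l]; omega))
    exact hu v (h.edge hv)
  refine ⟨l, ?_⟩
  -- The cheapest neighbour of `v` costs at most `l < n`, so only owning an item keeps `v` from
  -- bidding. By tightness that item costs at most `l + 1`, hence at most `l` by the choice of the
  -- level.
  have hX : ∀ v, (∃ w, E v w ∧ p w ≤ l) → ∃ w, o w = v + 1 ∧ p w ≤ l := by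
    rintro v ⟨w, hw, hwl⟩
    obtain ⟨x, hx, hxmin⟩ := Finset.exists_min_image (Finset.univ.filter (E v)) p ⟨w, by simpa⟩
    simp only [Finset.mem_filter, Finset.mem_univ, true_and] at hx hxmin
    have := hstable v x
    simp only [Bids, not_and, not_forall, not_not] at this
    obtain ⟨z, hz⟩ := this hx (lt_of_le_of_lt (hxmin w hw) (by omega)) hxmin
    exact ⟨z, hz, by have := h.tight hz hw; have := hl z; omega⟩
  choose! mate hmate hmatel using hX
  have hown : ∀ w, o w ≠ 0 → ∃ v : Fin n, o w = v + 1 := fun w => h.owner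
  choose! own hown using hown
  set M := Finset.univ.filter fun w => o w ≠ 0
  -- Dear items map to themselves, being sold; the remaining vertices of the cover are buyers and
  -- map to the item they own. The level `l` separates the two kinds of images.
  have h1 : (Finset.univ.filter (fun v => ∃ w, E v w ∧ p w ≤ l) ∪
      Finset.univ.filter fun w => (l : ℕ) < p w).card ≤ M.card := by
    refine Finset.card_le_card_of_injOn (fun x => if (l : ℕ) < p x then x else mate x) ?_ ?_
    · intro x hx
      simp only [Finset.coe_union, Finset.coe_filter, Finset.mem_univ, true_and, Set.mem_union,
        Set.mem_ofPred_eq] at hx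
      simp only [M, Finset.coe_filter, Finset.mem_univ, true_and, Set.mem_ofPred_eq]
      split_ifs with hlx
      · exact h.owned (by omega)
      · rw [hmate x (hx.resolve_right hlx)]; omega
    · intro x hx z hz hxz
      simp only [Finset.coe_union, Finset.coe_filter, Finset.mem_univ, true_and, Set.mem_union,
        Set.mem_ofPred_eq] at hx hz
      dsimp only at hxz
      split_ifs at hxz with hlx hlz hlz
      · exact hxz
      · have := hmatel z (hz.resolve_right hlz)
        rw [← hxz] at this
        omega
      · have := hmatel x (hx.resolve_right hlx)
        rw [hxz] at this
        omega
      · have h2 := hmate x (hx.resolve_right hlx)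
        rw [hxz, hmate z (hz.resolve_right hlz)] at h2
        exact Fin.ext (by omega)
  -- Weak duality: each matching edge uses up a vertex of `T` of its own, and that vertex avoids `D`
  -- because `D` meets no edge. Since no vertex is both buyer and item, vertices chosen on opposite
  -- sides cannot coincide.
  have h2 : M.card ≤ (T \ D).card := by
    have hM : ∀ w ∈ M, E (own w) w := fun w hw => h.edge (hown w (by simpa [M] using hw))
    refine Finset.card_le_card_of_injOn (fun w => if w ∈ T then w else own w) ?_ ?_
    · intro w hw
      have he := hM w hw
      simp only [Finset.coe_sdiff, Set.mem_sdiff, Finset.mem_coe]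
      split_ifs with hwT
      · exact ⟨hwT, (hD _ _ he).2⟩
      · exact ⟨(hcover _ _ he).resolve_right hwT, (hD _ _ he).1⟩
    · intro w hw x hx hwx
      have hew := hM w hw
      have hex := hM x hx
      dsimp only at hwx
      split_ifs at hwx
      · exact hwx
      · rw [hwx] at hew
        exact absurd hex (hdisj _ _ _ hew)
      · rw [← hwx] at hex
        exact absurd hew (hdisj _ _ _ hex)
      · have h3 := hown w (by simpa [M] using hw)
        rw [hwx, ← hown x (by simpa [M] using hx)] at h3
        exact h.inj h3 (by simpa [M] using hw)
  calc _ ≤ D.card + (T \ D).card := (Finset.card_union_le _ _).trans (by omega)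
    _ = T.card := by rw [add_comm, Finset.card_sdiff_add_card_eq_card hDT]

end Auction

/-! ### Split graphs -/

section Split

variable {n : ℕ}

open Classical in
/-- The vertices of degree at least `k`, and `u`. -/
def degreeCore (G : SimpleGraph (Fin n)) (k : ℕ) (u : Fin n) : Set (Fin n) :=
  {v | k ≤ (Finset.univ.filter fun w => G.Adj v w).card ∨ v = u}

open Classical in
-- For a largest clique `C` with independent complement, each vertex outside misses some vertex of
-- `C` and so has degree at most `|C| - 1`, while vertices of `C` have degree at least `|C| - 1`.
-- Degrees thus separate the two sides except for ties at `|C| - 1`, which the extra vertex `u`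
-- resolves.
theorem exists_degreeCore {G : SimpleGraph (Fin n)} (hG : IsSplit (Fin n) G) (hn : 0 < n) :
    ∃ k u : Fin n, G.IsClique (degreeCore G k u) ∧ G.IsIndepSet (degreeCore G k u)ᶜ := by
  obtain ⟨C₀, I₀, hU, hdis, hC₀, hI₀⟩ := hG
  have hI : I₀ = C₀ᶜ := (IsCompl.of_eq hdis.eq_bot hU).eq_compl.symm ▸ by simp
  subst hI
  obtain ⟨C, hC, hmax⟩ := Finset.exists_max_image
    (Finset.univ.filter fun C : Finset (Fin n) =>
      G.IsClique (C : Set (Fin n)) ∧ G.IsIndepSet (C : Set (Fin n))ᶜ) Finset.card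
    ⟨C₀.toFinset, by
      rw [Finset.mem_filter, Set.coe_toFinset]
      exact ⟨Finset.mem_univ _, hC₀, hI₀⟩⟩
  simp only [Finset.mem_filter, Finset.mem_univ, true_and] at hC hmax
  obtain ⟨hCc, hCi⟩ := hC
  have hmiss : ∀ v ∉ C, ∃ x ∈ C, ¬ G.Adj v x := by
    by_contra! hcon
    obtain ⟨v, hv, hadj⟩ := hcon
    have := hmax (insert v C) ⟨by
      rw [Finset.coe_insert]
      exact hCc.insert fun x hx _ => hadj x hx, hCi.mono (by simp)⟩
    rw [Finset.card_insert_of_notMem hv] at this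
    omega
  have hin : ∀ v ∈ C, C.erase v ⊆ Finset.univ.filter fun w => G.Adj v w := by
    intro v hv w hw
    rw [Finset.mem_erase] at hw
    simpa using hCc hv hw.2 hw.1.symm
  have hout : ∀ v ∉ C, ∃ x ∈ C, (Finset.univ.filter fun w => G.Adj v w) ⊆ C.erase x := by
    intro v hv
    obtain ⟨x, hx, hvx⟩ := hmiss v hv
    refine ⟨x, hx, fun w hw => ?_⟩
    simp only [Finset.mem_filter, Finset.mem_univ, true_and] at hw
    refine Finset.mem_erase.2 ⟨fun h => hvx (h ▸ hw), by_contra fun hwC => ?_⟩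
    exact hCi (by simpa using hv) (by simpa using hwC) hw.ne hw
  obtain ⟨c, hc⟩ : C.Nonempty := by
    rw [Finset.nonempty_iff_ne_empty]
    rintro rfl
    obtain ⟨x, hx, -⟩ := hmiss ⟨0, hn⟩ (by simp)
    simp at hx
  have hpos : 0 < C.card := Finset.card_pos.2 ⟨c, hc⟩
  have hle : C.card ≤ n := by simpa using Finset.card_le_univ C
  suffices H : ∃ k u : Fin n, degreeCore G k u = C by
    obtain ⟨k, u, h⟩ := H
    exact ⟨k, u, h ▸ hCc, h ▸ hCi⟩
  -- If some `v` outside `C` has degree `|C| - 1`, its neighbourhood is `C` minus one vertex `x`.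
  -- All other vertices of `C` then see `v` as well and have degree at least `|C|`, so the threshold
  -- `|C|` with `u = x` works. It is below `n` because `v ∉ C`. Without a tie, the threshold `|C| -
  -- 1` works with any `u` in `C`.
  by_cases htie : ∃ v ∉ C, C.card - 1 ≤ (Finset.univ.filter fun w => G.Adj v w).card
  · obtain ⟨v, hv, hdeg⟩ := htie
    obtain ⟨x, hx, hsub⟩ := hout v hv
    have heq := Finset.eq_of_subset_of_card_le hsub (by rwa [Finset.card_erase_of_mem hx])
    have hlt : C.card < n := by simpa using Finset.card_lt_univ_of_notMem hv
    refine ⟨⟨C.card, hlt⟩, x, Set.ext fun a => ?_⟩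
    simp only [degreeCore, Set.mem_ofPred_eq, Finset.mem_coe]
    constructor
    · rintro (ha | rfl)
      · by_contra haC
        obtain ⟨z, hz, hsub⟩ := hout a haC
        have := Finset.card_le_card hsub
        rw [Finset.card_erase_of_mem hz] at this
        omega
      · exact hx
    · intro ha
      by_cases hax : a = x
      · exact Or.inr hax
      · left
        have hva : G.Adj v a := by
          have : a ∈ C.erase x := Finset.mem_erase.2 ⟨hax, ha⟩
          rw [← heq] at this
          simpa using this
        have := Finset.card_le_card (Finset.insert_subset
          (show v ∈ Finset.univ.filter fun w => G.Adj a w by simpa using hva.symm) (hin a ha))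
        rw [Finset.card_insert_of_notMem (fun h => hv (Finset.mem_of_mem_erase h)),
          Finset.card_erase_of_mem ha] at this
        omega
  · push Not at htie
    refine ⟨⟨C.card - 1, by omega⟩, c, Set.ext fun a => ?_⟩
    simp only [degreeCore, Set.mem_ofPred_eq, Finset.mem_coe]
    constructor
    · rintro (ha | rfl)
      · by_contra haC
        have := htie a haC
        omega
      · exact hc
    · intro ha
      left
      have := Finset.card_le_card (hin a ha)
      rwa [Finset.card_erase_of_mem ha] at this

/-- Adjacency is transitive outside `S`. -/
def TransitiveOutside (G : SimpleGraph (Fin n)) (S : Finset (Fin n)) : Prop :=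
  ∀ a b c, a ∈ S ∨ b ∈ S ∨ c ∈ S ∨ a = c ∨ ¬ G.Adj a b ∨ ¬ G.Adj b c ∨ G.Adj a c

/-- An induced `P₃` is a failure of transitivity. An induced `2K₂` cannot occur: each of its edges
has an end in the clique, and these two ends would be adjacent. -/
theorem isDeletionSet_iff {G : SimpleGraph (Fin n)} (hG : IsSplit (Fin n) G)
    (S : Finset (Fin n)) :
    IsDeletionSet Is2K2P3Free G S ↔ TransitiveOutside G S := by
  constructor
  · rintro ⟨-, h⟩ a b c
    by_contra! hcon
    obtain ⟨ha, hb, hc, hac, hab, hbc, hnac⟩ := hcon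
    let f : Fin 3 → {v : Fin n | v ∉ S} := ![⟨a, ha⟩, ⟨b, hb⟩, ⟨c, hc⟩]
    have hf : ∀ i j, G.Adj (f i) (f j) ↔ (SimpleGraph.pathGraph 3).Adj i j := by
      intro i j
      have := hab.symm
      have := hbc.symm
      have : ¬ G.Adj c a := fun h => hnac h.symm
      fin_cases i <;> fin_cases j <;> simp [f, SimpleGraph.pathGraph_adj, *]
    refine h ⟨⟨⟨f, ?_⟩, fun {i j} => hf i j⟩⟩
    intro i j hij
    have := hab.ne
    have := hbc.ne
    fin_cases i <;> fin_cases j <;> simp_all [f]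
  · intro h
    refine ⟨?_, ?_⟩
    · rintro ⟨f⟩
      obtain ⟨C, I, hU, hdis, hC, hI⟩ := hG
      have key : ∀ x y, twoK2.Adj x y → (f x : Fin n) ∈ C ∨ (f y : Fin n) ∈ C := by
        intro x y hxy
        by_contra! hcon
        have hadj : G.Adj (f x) (f y) := by simpa using f.map_rel_iff.2 hxy
        have hmem : ∀ z : Fin n, z ∉ C → z ∈ I := fun z hz =>
          (hU.symm ▸ Set.mem_univ z : z ∈ C ∪ I).resolve_left hz
        exact hI (hmem _ hcon.1) (hmem _ hcon.2) hadj.ne hadj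
      have hl := key (.inl 0) (.inl 1) (by simp [twoK2])
      have hr := key (.inr 0) (.inr 1) (by simp [twoK2])
      have cross : ∀ i j, (f (.inl i) : Fin n) ∈ C → (f (.inr j) : Fin n) ∉ C := by
        intro i j hi hj
        have hadj : G.Adj (f (.inl i)) (f (.inr j)) := hC hi hj fun heq =>
          Sum.inl_ne_inr (f.injective (Subtype.ext heq))
        have : twoK2.Adj (.inl i) (.inr j) := f.map_rel_iff.1 (by simpa using hadj)
        simp [twoK2] at this
      rcases hl with hl | hl <;> rcases hr with hr | hr <;> exact cross _ _ hl hr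
    · rintro ⟨f⟩
      have h01 : G.Adj (f 0) (f 1) := by
        simpa using f.map_rel_iff.2 (show (SimpleGraph.pathGraph 3).Adj 0 1 by
          simp [SimpleGraph.pathGraph_adj])
      have h12 : G.Adj (f 1) (f 2) := by
        simpa using f.map_rel_iff.2 (show (SimpleGraph.pathGraph 3).Adj 1 2 by
          simp [SimpleGraph.pathGraph_adj])
      have h02 : ¬ G.Adj (f 0) (f 2) := fun hadj => by
        have : (SimpleGraph.pathGraph 3).Adj 0 2 := f.map_rel_iff.1 (by simpa using hadj)
        simp [SimpleGraph.pathGraph_adj] at this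
      have hne : (f 0 : Fin n) ≠ f 2 := fun heq =>
        absurd (f.injective (Subtype.ext heq)) (by decide)
      have hm : ∀ i, (f i : Fin n) ∉ S := fun i => (f i).2
      rcases h (f 0) (f 1) (f 2) with h | h | h | h | h | h | h
      exacts [hm _ h, hm _ h, hm _ h, hne h, h h01, h h12, h02 h]

/-- The edges between the closed neighbourhood of `y` in `C` and the vertices outside `C`, except
`y`. -/
def CoreEdge (G : SimpleGraph (Fin n)) (C : Set (Fin n)) (y v w : Fin n) : Prop :=
  (v ∈ C ∧ (v = y ∨ G.Adj v y)) ∧ (w ∉ C ∧ w ≠ y) ∧ G.Adj v w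

/-- The vertices of `C` outside the closed neighbourhood of `y`, and the vertex cover of the edges
`CoreEdge G C y` that price level `l` gives. -/
def Candidate (G : SimpleGraph (Fin n)) (C : Set (Fin n)) (y : Fin n) (p : Fin n → ℕ) (l : ℕ)
    (v : Fin n) : Prop :=
  (v ∈ C ∧ ¬ (v = y ∨ G.Adj v y)) ∨ (∃ w, CoreEdge G C y v w ∧ p w ≤ l) ∨
    ((v ∉ C ∧ v ≠ y) ∧ l < p v)

/-- For arbitrary prices and any level, an edge `v w` of `CoreEdge` is covered by `v` if `p w ≤ l`
and by `w` otherwise. Among survivors, only `y` can therefore be a vertex outside `C` with a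
neighbour in `C`, and all surviving vertices of `C` are equal or adjacent to `y`. -/
theorem transitiveOutside_candidate {G : SimpleGraph (Fin n)} {C : Set (Fin n)}
    (hC : G.IsClique C) (hI : G.IsIndepSet Cᶜ) {y : Fin n} {p : Fin n → ℕ} {l : ℕ}
    {S : Finset (Fin n)} (hS : ∀ v, v ∈ S ↔ Candidate G C y p l v) : TransitiveOutside G S := by
  have hnear : ∀ v ∈ C, v ∉ S → v = y ∨ G.Adj v y := fun v hv hvS => by
    by_contra hcon
    exact hvS ((hS v).2 (.inl ⟨hv, hcon⟩))
  have hcov : ∀ v w, v ∉ S → w ∉ S → v ∈ C → w ∉ C → G.Adj v w → w = y := by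
    intro v w hv hw hvC hwC hadj
    by_contra hwy
    have he : CoreEdge G C y v w := ⟨⟨hvC, hnear v hvC hv⟩, ⟨hwC, hwy⟩, hadj⟩
    rcases le_or_gt (p w) l with hl | hl
    · exact hv ((hS v).2 (.inr (.inl ⟨w, he, hl⟩)))
    · exact hw ((hS w).2 (.inr (.inr ⟨⟨hwC, hwy⟩, hl⟩)))
  intro a b c
  by_contra! hcon
  obtain ⟨ha, hb, hc, hac, hab, hbc, hnac⟩ := hcon
  have hedge : ∀ x z, G.Adj x z → x ∈ C ∨ z ∈ C := fun x z hxz => by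
    by_contra! h
    exact hI h.1 h.2 hxz.ne hxz
  by_cases haC : a ∈ C <;> by_cases hcC : c ∈ C
  · exact hnac (hC haC hcC hac)
  · have hbC : b ∈ C := (hedge b c hbc).resolve_right hcC
    have hcy := hcov b c hb hc hbC hcC hbc
    subst hcy
    exact hnac ((hnear a haC ha).resolve_left hac)
  · have hbC : b ∈ C := (hedge a b hab).resolve_left haC
    have hay := hcov b a hb ha hbC haC hab.symm
    subst hay
    exact hnac ((hnear c hcC hc).resolve_left hac.symm).symm
  · have hbC : b ∈ C := (hedge a b hab).resolve_left haC
    exact hac ((hcov b a hb ha hbC haC hab.symm).trans (hcov b c hb hc hbC hcC hbc).symm)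

/-- A surviving edge `i x` leaving `C` makes `i` the centre: the path `i, x, v` forces every
survivor `v` of `C` to be adjacent to `i`, and the path `i, v, w` then excludes any other surviving
edge `v w` leaving `C`. Without such an edge `u` serves, since it is adjacent to the rest of `C` and
`T` already covers everything. -/
theorem exists_centre {G : SimpleGraph (Fin n)} {C : Set (Fin n)}
    (hC : G.IsClique C) (hI : G.IsIndepSet Cᶜ) {u : Fin n} (hu : u ∈ C) {T : Finset (Fin n)}
    (hT : TransitiveOutside G T) :
    ∃ y, (∀ v ∈ C, ¬ (v = y ∨ G.Adj v y) → v ∈ T) ∧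
      ∀ v w, CoreEdge G C y v w → v ∈ T ∨ w ∈ T := by
  by_cases h : ∃ i x, i ∉ C ∧ i ∉ T ∧ x ∈ C ∧ x ∉ T ∧ G.Adj i x
  · obtain ⟨i, x, hiC, hiT, hxC, hxT, hix⟩ := h
    have hall : ∀ v ∈ C, v ∉ T → G.Adj i v := by
      intro v hv hvT
      by_cases hxv : x = v
      · rwa [← hxv]
      · have hadj := hC hxC hv hxv
        have hne : i ≠ v := fun h => hiC (h ▸ hv)
        have := hT i x v
        tauto
    refine ⟨i, fun v hv hvi => ?_, ?_⟩
    · by_contra hvT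
      exact hvi (.inr (hall v hv hvT).symm)
    · rintro v w ⟨⟨hvC, -⟩, ⟨hwC, hwi⟩, hvw⟩
      by_contra! hcon
      have h1 := hall v hvC hcon.1
      have h2 : ¬ G.Adj i w := hI hiC hwC hwi.symm
      have := hT i v w
      have := hwi.symm
      tauto
  · push Not at h
    refine ⟨u, fun v hv hvu => ?_, ?_⟩
    · push Not at hvu
      exact absurd (hC hv hu hvu.1) hvu.2
    · rintro v w ⟨⟨hvC, -⟩, ⟨hwC, -⟩, hvw⟩
      by_contra! hcon
      exact h w v hwC hcon.2 hvC hcon.1 hvw.symm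

open Classical in
/-- When nobody bids any more, some price level gives a deletion set that is at most as large
as `T`. -/
theorem exists_candidate_card_le {G : SimpleGraph (Fin n)} {C : Set (Fin n)} {u y : Fin n}
    (hu : u ∈ C) {T : Finset (Fin n)} (hT : ∀ v ∈ C, ¬ (v = y ∨ G.Adj v y) → v ∈ T)
    (hcover : ∀ v w, CoreEdge G C y v w → v ∈ T ∨ w ∈ T) {p o : Fin n → ℕ}
    (h : IsAuction (CoreEdge G C y) p o) (hstable : ∀ v w, ¬ Bids (CoreEdge G C y) p o v w) :
    ∃ l : Fin n, ∀ S : Finset (Fin n), (∀ v, v ∈ S ↔ Candidate G C y p l v) →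
      S.card ≤ T.card := by
  -- The vertex `u` lies in `C`, so it is never the right end of an edge: it is the item that cannot
  -- be sold. The set `D` consists of the deletions forced by the centre.
  obtain ⟨l, hl⟩ := h.exists_level hstable (u := u) (fun v hv => hv.2.1.1 hu)
    (fun v w x hvw hwx => hvw.2.1.1 hwx.1.1)
    (D := Finset.univ.filter fun v => v ∈ C ∧ ¬ (v = y ∨ G.Adj v y)) hcover
    (fun v hv => by
      simp only [Finset.mem_filter, Finset.mem_univ, true_and] at hv
      exact hT v hv.1 hv.2)
    (fun v w hvw => by
      simp only [Finset.mem_filter, Finset.mem_univ, true_and, not_and, not_not]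
      exact ⟨fun _ => hvw.1.2, fun hw => absurd hw hvw.2.1.1⟩)
  refine ⟨l, fun S hS => (Finset.card_le_card fun v hv => ?_).trans hl⟩
  rw [hS] at hv
  simp only [Finset.mem_union, Finset.mem_filter, Finset.mem_univ, true_and]
  exact hv.imp id (Or.imp id And.right)

end Split

/-! ### The program -/

namespace RAM

/-! Variables `1`, `2`, `3` hold `k`, `u`, `y`, where `u` and the vertices of degree at least `k`
form the clique of a split partition, and `y` is the centre. Variable `7` holds the price level and
variable `8` the size of the best deletion set so far. Prices stand in bank `2` and owners in
bank `3`. -/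

/-- Summing the value of `i` over `n` rounds gives the row offset without multiplication. Variable
`0` is the dummy of this sum, and `10` to `14` are bound in the conditions below, whence the side
conditions `i ≠ 0`, `i ≠ 10`, `i ≠ 11` in the lemmas about them. -/
def adjE (i j : ℕ) : Expr := .load 0 (.add (.sum 0 (.var i)) (.var j))
def coreE (i : ℕ) : Expr := .or (.le (.var 1) (.count 10 (adjE i 10))) (.eq (.var i) (.var 2))
def nearE (i : ℕ) : Expr := .or (.eq (.var i) (.var 3)) (adjE i 3)
def rightE (i : ℕ) : Expr := .and (.not (coreE i)) (.not (.eq (.var i) (.var 3)))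
def edgeE (i j : ℕ) : Expr := .and (.and (coreE i) (nearE i)) (.and (rightE j) (adjE i j))
def priceE (i : ℕ) : Expr := .load 2 (.var i)

def bidE : Expr :=
  .and (edgeE 5 6) <| .and (.lt (priceE 6) .size) <|
  .and (.all 11 (.or (.not (edgeE 5 11)) (.le (priceE 6) (priceE 11))))
    (.all 11 (.not (.eq (.load 3 (.var 11)) (.add (.var 5) (.lit 1)))))

def candidateE (i : ℕ) : Expr :=
  .or (.and (coreE i) (.not (nearE i))) <|
  .or (.ex 11 (.and (edgeE i 11) (.le (priceE 11) (.var 7))))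
    (.and (rightE i) (.lt (.var 7) (priceE i)))

/-- This test is needed because for a wrong choice of `k` and `u` a candidate need not be a deletion
set. -/
def validE : Expr :=
  .all 12 <| .all 13 <| .all 14 <|
  .or (candidateE 12) <| .or (candidateE 13) <| .or (candidateE 14) <|
  .or (.eq (.var 12) (.var 14)) <| .or (.not (adjE 12 13)) <| .or (.not (adjE 13 14)) (adjE 12 14)

def resetS : Stmt := .loop 6 (.seq (.store 2 (.var 6) (.lit 0)) (.store 3 (.var 6) (.lit 0)))

def bidS : Stmt :=
  .ite bidE <| .seq (.store 3 (.var 6) (.add (.var 5) (.lit 1)))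
    (.store 2 (.var 6) (.add (priceE 6) (.lit 1)))

def roundS : Stmt := .loop 5 (.loop 6 bidS)

/-- Variables `4` and `9` only count the `n * n` rounds: a round in which somebody can bid raises
the total price, which stays below `n * n`. -/
def auctionS : Stmt := .loop 4 (.loop 9 roundS)

def keepS : Stmt :=
  .ite (.and (.lt (.count 5 (candidateE 5)) (.var 8)) validE) <|
  .seq (.assign 8 (.count 5 (candidateE 5))) (.loop 5 (.store 1 (.var 5) (candidateE 5)))

def centreS : Stmt := .seq resetS (.seq auctionS (.loop 7 keepS))

def deletionS : Stmt :=
  .seq (.assign 8 .size) <| .seq (.loop 5 (.store 1 (.var 5) (.lit 1))) <|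
  .loop 1 (.loop 2 (.loop 3 centreS))

variable {n : ℕ} {G : SimpleGraph (Fin n)}

/-! ### Meaning of the expressions of the program. -/

/-- The memory contains the adjacency matrix of `G`, and `k`, `u`, `y` are as given. -/
structure Context (G : SimpleGraph (Fin n)) (k : ℕ) (u y : Fin n) (τ : State) : Prop where
  mem : τ.mem 0 = (graphInput G).mem 0
  core : τ.reg 1 = k
  apex : τ.reg 2 = u
  centre : τ.reg 3 = y

theorem Context.setReg {k : ℕ} {u y : Fin n} {τ : State} (h : Context G k u y τ) {i : ℕ}
    (hi : 3 < i) (x : ℕ) : Context G k u y (τ.setReg i x) where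
  mem := h.mem
  core := by rw [State.reg_setReg, if_neg (by omega), h.core]
  apex := by rw [State.reg_setReg, if_neg (by omega), h.apex]
  centre := by rw [State.reg_setReg, if_neg (by omega), h.centre]

theorem Context.run {k : ℕ} {u y : Fin n} {τ : State} (h : Context G k u y τ) {p : Stmt}
    (h0 : ¬ p.WritesBank 0) (h1 : ¬ p.WritesVar 1) (h2 : ¬ p.WritesVar 2)
    (h3 : ¬ p.WritesVar 3) : Context G k u y (p.run n τ) where
  mem := by rw [Stmt.mem_run h0, h.mem]
  core := by rw [Stmt.reg_run h1, h.core]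
  apex := by rw [Stmt.reg_run h2, h.apex]
  centre := by rw [Stmt.reg_run h3, h.centre]

theorem holds_adjE {τ : State} (h : τ.mem 0 = (graphInput G).mem 0) {i j : ℕ} {a b : Fin n}
    (hi : τ.reg i = a) (hj : τ.reg j = b) (hi0 : i ≠ 0) :
    (adjE i j).Holds n τ ↔ G.Adj a b := by
  have hsum : (Expr.sum 0 (.var i)).eval n τ = a * n := by
    simp [Expr.eval, hi0, hi, mul_comm]
  rw [Expr.Holds, adjE, Expr.eval, Expr.eval, hsum, Expr.eval, hj, h]
  simp only [graphInput]
  split_ifs with hex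
  · obtain ⟨-, x, z, heq, hadj⟩ := hex
    -- Since column indices are below `n`, division of the address by `n` recovers the row.
    have hx : a = x := Fin.ext (by
      have := congrArg (· / n) heq
      simpa [Nat.add_div_of_dvd_right, Nat.div_eq_of_lt, a.pos, mul_comm _ n,
        Nat.mul_add_div a.pos] using this)
    subst hx
    have hz : b = z := Fin.ext (by omega)
    subst hz
    simpa using hadj
  · simp only [lt_irrefl, false_iff]
    exact fun hadj => hex ⟨rfl, a, b, rfl, hadj⟩

open Classical in
theorem Context.holds_coreE {k : ℕ} {u y : Fin n} {τ : State} (h : Context G k u y τ) {i : ℕ}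
    {a : Fin n} (hi : τ.reg i = a) (hi0 : i ≠ 0) (hi10 : i ≠ 10) :
    (coreE i).Holds n τ ↔ a ∈ degreeCore G k u := by
  have hadj : ∀ x : Fin n, (adjE i 10).Holds n (τ.setReg 10 x) ↔ G.Adj a x := fun x =>
    holds_adjE (τ := τ.setReg 10 x) h.mem (by simpa [hi10] using hi) (by simp) hi0
  have hcount : (Expr.count 10 (adjE i 10)).eval n τ =
      (Finset.univ.filter fun w => G.Adj a w).card := by
    rw [Expr.eval_count]
    congr 1
    exact Finset.filter_congr fun x _ => hadj x
  simp [coreE, degreeCore, hcount, Expr.eval, h.core, h.apex, hi, Fin.ext_iff]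

theorem Context.holds_nearE {k : ℕ} {u y : Fin n} {τ : State} (h : Context G k u y τ) {i : ℕ}
    {a : Fin n} (hi : τ.reg i = a) (hi0 : i ≠ 0) :
    (nearE i).Holds n τ ↔ a = y ∨ G.Adj a y := by
  simp [nearE, holds_adjE h.mem hi h.centre hi0, Expr.eval, h.centre, hi, Fin.ext_iff]

theorem Context.holds_rightE {k : ℕ} {u y : Fin n} {τ : State} (h : Context G k u y τ) {i : ℕ}
    {a : Fin n} (hi : τ.reg i = a) (hi0 : i ≠ 0) (hi10 : i ≠ 10) :
    (rightE i).Holds n τ ↔ a ∉ degreeCore G k u ∧ a ≠ y := by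
  simp [rightE, h.holds_coreE hi hi0 hi10, Expr.eval, h.centre, hi, Fin.ext_iff]

theorem Context.holds_edgeE {k : ℕ} {u y : Fin n} {τ : State} (h : Context G k u y τ) {i j : ℕ}
    {a b : Fin n} (hi : τ.reg i = a) (hj : τ.reg j = b) (hi0 : i ≠ 0) (hi10 : i ≠ 10)
    (hj0 : j ≠ 0) (hj10 : j ≠ 10) :
    (edgeE i j).Holds n τ ↔ CoreEdge G (degreeCore G k u) y a b := by
  simp [edgeE, CoreEdge, h.holds_coreE hi hi0 hi10, h.holds_nearE hi hi0,
    h.holds_rightE hj hj0 hj10, holds_adjE h.mem hi hj hi0]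

/-- The prices in bank `2`. -/
def prices (n : ℕ) (τ : State) (w : Fin n) : ℕ := τ.mem 2 w

/-- The owners in bank `3`. -/
def owners (n : ℕ) (τ : State) (w : Fin n) : ℕ := τ.mem 3 w

theorem Context.holds_bidE {k : ℕ} {u y : Fin n} {τ : State} (h : Context G k u y τ) {v w : Fin n}
    (hv : τ.reg 5 = v) (hw : τ.reg 6 = w) :
    bidE.Holds n τ ↔
      Bids (CoreEdge G (degreeCore G k u) y) (prices n τ) (owners n τ) v w := by
  have hedge : ∀ x : Fin n, (edgeE 5 11).Holds n (τ.setReg 11 x) ↔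
      CoreEdge G (degreeCore G k u) y v x := fun x =>
    (h.setReg (by omega) _).holds_edgeE (by simpa using hv) (by simp) (by simp) (by simp) (by simp)
      (by simp)
  simp [bidE, Bids, hedge, h.holds_edgeE hv hw, priceE, Expr.eval, hv, hw, prices, owners,
    imp_iff_not_or]

theorem Context.holds_candidateE {k : ℕ} {u y l : Fin n} {τ : State} (h : Context G k u y τ)
    (hl : τ.reg 7 = l) {i : ℕ} {v : Fin n} (hv : τ.reg i = v) (hi0 : i ≠ 0) (hi10 : i ≠ 10)
    (hi11 : i ≠ 11) :
    (candidateE i).Holds n τ ↔ Candidate G (degreeCore G k u) y (prices n τ) l v := by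
  have hedge : ∀ x : Fin n, (edgeE i 11).Holds n (τ.setReg 11 x) ↔
      CoreEdge G (degreeCore G k u) y v x := fun x =>
    (h.setReg (by omega) _).holds_edgeE (by simpa [hi11] using hv) (by simp) hi0 hi10 (by simp)
      (by simp)
  simp [candidateE, Candidate, hedge, h.holds_coreE hv hi0 hi10, h.holds_nearE hv hi0,
    h.holds_rightE hv hi0 hi10, priceE, Expr.eval, hv, hl, prices]

theorem Context.holds_validE {k : ℕ} {u y l : Fin n} {τ : State} (h : Context G k u y τ)
    (hl : τ.reg 7 = l) {S : Finset (Fin n)}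
    (hS : ∀ v, v ∈ S ↔ Candidate G (degreeCore G k u) y (prices n τ) l v) :
    validE.Holds n τ ↔ TransitiveOutside G S := by
  simp only [validE, Expr.holds_all, TransitiveOutside, hS]
  refine forall_congr' fun a => forall_congr' fun b => forall_congr' fun c => ?_
  have h' := ((h.setReg (i := 12) (by omega) a).setReg (i := 13) (by omega) b).setReg
    (i := 14) (by omega) c
  have hl' : (((τ.setReg 12 a).setReg 13 b).setReg 14 c).reg 7 = l := by simpa using hl
  have ha : (((τ.setReg 12 a).setReg 13 b).setReg 14 c).reg 12 = a := by simp
  have hb : (((τ.setReg 12 a).setReg 13 b).setReg 14 c).reg 13 = b := by simp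
  have hc : (((τ.setReg 12 a).setReg 13 b).setReg 14 c).reg 14 = c := by simp
  simp only [Expr.holds_or, Expr.holds_not, Expr.holds_eq, Expr.eval,
    holds_adjE h'.mem ha hb (by decide), holds_adjE h'.mem hb hc (by decide),
    holds_adjE h'.mem ha hc (by decide),
    h'.holds_candidateE hl' ha (by decide) (by decide) (by decide),
    h'.holds_candidateE hl' hb (by decide) (by decide) (by decide),
    h'.holds_candidateE hl' hc (by decide) (by decide) (by decide), ha, hc, Fin.ext_iff]
  rfl

/-! ### The auction -/

/-- From `τ` to `τ'`, either nothing has changed and nobody in `D` bids, or somebody bids and prices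
have gone up. -/
def Progress (E : Fin n → Fin n → Prop) (D : Fin n → Fin n → Prop) (τ τ' : State) : Prop :=
  IsAuction E (prices n τ') (owners n τ') ∧
    ((prices n τ' = prices n τ ∧ owners n τ' = owners n τ ∧
      ∀ v w, D v w → ¬ Bids E (prices n τ) (owners n τ) v w) ∨
    (∃ v w, Bids E (prices n τ) (owners n τ) v w) ∧ ∑ w, prices n τ w < ∑ w, prices n τ' w)

theorem Progress.refl {E : Fin n → Fin n → Prop} {τ : State}
    (h : IsAuction E (prices n τ) (owners n τ)) : Progress E (fun _ _ => False) τ τ :=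
  ⟨h, .inl ⟨rfl, rfl, fun _ _ h => h.elim⟩⟩

/-- If the first part changes nothing, bids before and after it are the same, so the sets of pairs
known not to bid add up. Once the total price has risen, a later part cannot lower it. -/
theorem Progress.trans {E D D' D'' : Fin n → Fin n → Prop} {τ τ' τ'' : State}
    (h : Progress E D τ τ') (h' : Progress E D' τ' τ'') (hD : ∀ v w, D'' v w → D v w ∨ D' v w) :
    Progress E D'' τ τ'' := by
  refine ⟨h'.1, ?_⟩
  rcases h.2 with ⟨hp, ho, hb⟩ | ⟨hex, hlt⟩ <;> rcases h'.2 with ⟨hp', ho', hb'⟩ | ⟨hex', hlt'⟩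
  · rw [hp, ho] at hb'
    exact .inl ⟨hp'.trans hp, ho'.trans ho, fun v w hvw => (hD v w hvw).elim (hb v w) (hb' v w)⟩
  · rw [hp] at hlt' hex'
    rw [ho] at hex'
    exact .inr ⟨hex', hlt'⟩
  · rw [hp']
    exact .inr ⟨hex, hlt⟩
  · exact .inr ⟨hex, hlt.trans hlt'⟩

theorem Context.run_bidS {k : ℕ} {u y : Fin n} {τ : State} (h : Context G k u y τ) {v w : Fin n}
    (hv : τ.reg 5 = v) (hw : τ.reg 6 = w)
    (ha : IsAuction (CoreEdge G (degreeCore G k u) y) (prices n τ) (owners n τ)) :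
    Progress (CoreEdge G (degreeCore G k u) y) (fun a b => a = v ∧ b = w) τ (bidS.run n τ) := by
  rw [bidS, Stmt.run]
  have hbid := h.holds_bidE hv hw
  rw [Expr.Holds] at hbid
  split_ifs with hb
  · rw [hbid] at hb
    set τ' := ((Stmt.store 3 (.var 6) (.add (.var 5) (.lit 1))).seq
      (.store 2 (.var 6) (.add (priceE 6) (.lit 1)))).run n τ
    have hp : prices n τ' = Function.update (prices n τ) w (prices n τ w + 1) := by
      funext x
      simp [τ', prices, Stmt.run, Expr.eval, priceE, State.mem_setMem, hw, Function.update_apply,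
        Fin.ext_iff]
    have ho : owners n τ' = Function.update (owners n τ) w (v + 1) := by
      funext x
      simp [τ', owners, Stmt.run, Expr.eval, State.mem_setMem, hv, hw, Function.update_apply,
        Fin.ext_iff]
    refine ⟨by rw [hp, ho]; exact ha.bid hb, .inr ⟨⟨v, w, hb⟩, ?_⟩⟩
    rw [hp]
    refine Finset.sum_lt_sum (fun x _ => ?_) ⟨w, Finset.mem_univ w, by simp⟩
    rw [Function.update_apply]
    split_ifs with hx
    · rw [hx]; omega
    · rfl
  · exact ⟨ha, .inl ⟨rfl, rfl, fun a b hab => by rw [hab.1, hab.2, ← hbid]; exact hb⟩⟩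

theorem Context.run_roundS {k : ℕ} {u y : Fin n} {τ : State} (h : Context G k u y τ)
    (ha : IsAuction (CoreEdge G (degreeCore G k u) y) (prices n τ) (owners n τ)) :
    Progress (CoreEdge G (degreeCore G k u) y) (fun _ _ => True) τ (roundS.run n τ) := by
  have H := Stmt.run_loop_induction (n := n) (v := 5) (p := .loop 6 bidS) (σ := τ)
    (fun i ρ => Context G k u y ρ ∧
      Progress (CoreEdge G (degreeCore G k u) y) (fun a _ => (a : ℕ) < i) τ ρ)
    ⟨h, (Progress.refl ha).trans (Progress.refl ha) (by simp)⟩ (by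
      rintro i hi ρ ⟨hc, hprog⟩
      have H := Stmt.run_loop_induction (n := n) (v := 6) (p := bidS) (σ := ρ.setReg 5 i)
        (fun j π => Context G k u y π ∧ π.reg 5 = i ∧
          Progress (CoreEdge G (degreeCore G k u) y) (fun a b => (a : ℕ) = i ∧ (b : ℕ) < j) ρ π)
        ⟨hc.setReg (by omega) _, by simp,
          (Progress.refl hprog.1).trans (Progress.refl hprog.1) (by simp)⟩ (by
          rintro j hj π ⟨hc', h5, hprog'⟩
          have hc'' := hc'.setReg (i := 6) (by omega) j
          have h5' : (π.setReg 6 j).reg 5 = (⟨i, hi⟩ : Fin n) := by simpa using h5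
          have hstep := hc''.run_bidS h5' (w := ⟨j, hj⟩) (by simp) hprog'.1
          refine ⟨hc''.run ?_ ?_ ?_ ?_, ?_, hprog'.trans hstep ?_⟩
          any_goals simp [bidS, Stmt.WritesBank, Stmt.WritesVar]
          · rw [Stmt.reg_run (by simp [Stmt.WritesVar])]
            exact h5'
          · rintro a b rfl hb
            rcases Nat.le_iff_lt_or_eq.1 hb with hb | hb
            · exact .inl ⟨rfl, hb⟩
            · exact .inr ⟨rfl, Fin.ext hb⟩)
      refine ⟨H.1, hprog.trans H.2.2 fun a b hab => ?_⟩
      rcases Nat.lt_succ_iff_lt_or_eq.1 hab with hab | hab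
      · exact .inl hab
      · exact .inr ⟨hab, b.2⟩)
  exact H.2.trans (Progress.refl H.2.1) fun a _ _ => .inl a.2

theorem Context.run_auctionS {k : ℕ} {u y : Fin n} {τ : State} (h : Context G k u y τ)
    (ha : IsAuction (CoreEdge G (degreeCore G k u) y) (prices n τ) (owners n τ)) :
    IsAuction (CoreEdge G (degreeCore G k u) y) (prices n (auctionS.run n τ))
        (owners n (auctionS.run n τ)) ∧
      ∀ v w, ¬ Bids (CoreEdge G (degreeCore G k u) y) (prices n (auctionS.run n τ))
        (owners n (auctionS.run n τ)) v w := by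
  set E := CoreEdge G (degreeCore G k u) y
  -- After `r` rounds either bidding has stopped or each round has raised the total price by at
  -- least one.
  let Inv (r : ℕ) (ρ : State) : Prop := Context G k u y ρ ∧
    IsAuction E (prices n ρ) (owners n ρ) ∧
    ((∀ v w, ¬ Bids E (prices n ρ) (owners n ρ) v w) ∨ r ≤ ∑ w, prices n ρ w)
  have H : Inv (n * n) (auctionS.run n τ) :=
    Stmt.run_loop_induction (fun i => Inv (i * n)) ⟨h, ha, .inr (by simp)⟩ fun i hi ρ hρ => by
      have := Stmt.run_loop_induction (n := n) (v := 9) (p := roundS) (σ := ρ.setReg 4 i)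
        (fun j => Inv (i * n + j)) ⟨hρ.1.setReg (by omega) _, hρ.2⟩ fun j hj π hπ => by
          have hc := hπ.1.setReg (i := 9) (by omega) j
          have hprog : Progress E _ π _ := hc.run_roundS hπ.2.1
          refine ⟨hc.run ?_ ?_ ?_ ?_, hprog.1, ?_⟩
          any_goals simp [roundS, bidS, Stmt.WritesBank, Stmt.WritesVar]
          rcases hprog.2 with ⟨hp, ho, hb⟩ | ⟨⟨v, w, hvw⟩, hlt⟩
          · left
            change ∀ v w, ¬ Bids E (prices n (roundS.run n (π.setReg 9 j)))
              (owners n (roundS.run n (π.setReg 9 j))) v w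
            rw [hp, ho]
            exact fun v w => hb v w trivial
          · rcases hπ.2.2 with hs | hle
            · exact absurd hvw (hs v w)
            · right
              exact Nat.lt_of_le_of_lt hle hlt
      rwa [Nat.succ_mul]
  refine ⟨H.2.1, H.2.2.resolve_right fun hle => absurd hle (not_le.2 ?_)⟩
  -- The vertex `u` belongs to the core, so it is never sold and costs nothing; this makes the bound
  -- `n * n` on the total price strict and rules out the second alternative.
  have hu : prices n (auctionS.run n τ) u = 0 := by
    by_contra hne
    obtain ⟨v, hv⟩ := H.2.1.owner (H.2.1.owned (Nat.pos_of_ne_zero hne))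
    exact (H.2.1.edge hv).2.1.1 (.inr rfl)
  calc ∑ w, prices n (auctionS.run n τ) w < ∑ _w : Fin n, n :=
        Finset.sum_lt_sum (fun w _ => H.2.1.le w) ⟨u, Finset.mem_univ u, by rw [hu]; exact u.pos⟩
    _ = n * n := by simp

end RAM

namespace RAM

variable {n : ℕ} {G : SimpleGraph (Fin n)}

/-! ### The main loop -/

theorem prices_run_resetS (τ : State) : prices n (resetS.run n τ) = fun _ => 0 := by
  have H := Stmt.run_loop_induction (n := n) (v := 6)
    (p := .seq (.store 2 (.var 6) (.lit 0)) (.store 3 (.var 6) (.lit 0))) (σ := τ)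
    (fun j ρ => ∀ x < j, ρ.mem 2 x = 0) (by simp) fun j hj ρ hρ x hx => by
      simp only [Stmt.run, Expr.eval, State.mem_setMem, State.mem_setReg, State.reg_setReg,
        State.reg_setMem]
      by_cases hxj : x = j
      · simp [hxj]
      · simpa [hxj] using hρ x (by omega)
  exact funext fun x => H x x.2

theorem owners_run_resetS (τ : State) : owners n (resetS.run n τ) = fun _ => 0 := by
  have H := Stmt.run_loop_induction (n := n) (v := 6)
    (p := .seq (.store 2 (.var 6) (.lit 0)) (.store 3 (.var 6) (.lit 0))) (σ := τ)
    (fun j ρ => ∀ x < j, ρ.mem 3 x = 0) (by simp) fun j hj ρ hρ x hx => by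
      simp only [Stmt.run, Expr.eval, State.mem_setMem, State.mem_setReg, State.reg_setReg,
        State.reg_setMem]
      by_cases hxj : x = j
      · simp [hxj]
      · simpa [hxj] using hρ x (by omega)
  exact funext fun x => H x x.2

/-- Bank `1` holds a deletion set, and variable `8` a bound on its size that is at most `m`. -/
structure Best (G : SimpleGraph (Fin n)) (m : ℕ) (τ : State) : Prop where
  mem : τ.mem 0 = (graphInput G).mem 0
  valid : TransitiveOutside G (vertexSetOutput n τ)
  card_le : (vertexSetOutput n τ).card ≤ τ.reg 8
  le : τ.reg 8 ≤ m

theorem vertexSetOutput_congr {τ τ' : State} (h : τ.mem 1 = τ'.mem 1) :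
    vertexSetOutput n τ = vertexSetOutput n τ' := by
  simp [vertexSetOutput, h]

theorem Best.congr {m : ℕ} {τ τ' : State} (h : Best G m τ) (h0 : τ'.mem 0 = τ.mem 0)
    (h1 : τ'.mem 1 = τ.mem 1) (h8 : τ'.reg 8 = τ.reg 8) : Best G m τ' where
  mem := h0.trans h.mem
  valid := by rw [vertexSetOutput_congr h1]; exact h.valid
  card_le := by rw [vertexSetOutput_congr h1, h8]; exact h.card_le
  le := h8.trans_le h.le

theorem Best.setReg {m : ℕ} {τ : State} (h : Best G m τ) {i : ℕ} (hi : 8 ≠ i) (x : ℕ) :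
    Best G m (τ.setReg i x) :=
  h.congr rfl rfl (by rw [State.reg_setReg, if_neg hi])

theorem Best.run {m : ℕ} {τ : State} (h : Best G m τ) {p : Stmt} (h0 : ¬ p.WritesBank 0)
    (h1 : ¬ p.WritesBank 1) (h8 : ¬ p.WritesVar 8) : Best G m (p.run n τ) :=
  h.congr (Stmt.mem_run h0 τ) (Stmt.mem_run h1 τ) (Stmt.reg_run h8 τ)

open Classical in
-- A valid candidate either replaces the stored set or was already no smaller than the bound in
-- variable `8`; in both cases the new bound is at most its size.
theorem Context.run_keepS {k : ℕ} {u y l : Fin n} {τ : State} (h : Context G k u y τ)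
    (hl : τ.reg 7 = l) {m : ℕ} (hb : Best G m τ) :
    Best G m (keepS.run n τ) ∧ ∀ S : Finset (Fin n),
      (∀ v, v ∈ S ↔ Candidate G (degreeCore G k u) y (prices n τ) l v) →
      TransitiveOutside G S → Best G S.card (keepS.run n τ) := by
  set S := Finset.univ.filter (Candidate G (degreeCore G k u) y (prices n τ) l) with hS
  have hmem : ∀ v, v ∈ S ↔ Candidate G (degreeCore G k u) y (prices n τ) l v := by simp [hS]
  have hvalid := h.holds_validE hl hmem
  have hcard : (Expr.count 5 (candidateE 5)).eval n τ = S.card := by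
    rw [Expr.eval_count, hS]
    congr 1
    refine Finset.filter_congr fun v _ => ?_
    exact (h.setReg (i := 5) (by omega) v).holds_candidateE (by simpa using hl) (by simp)
      (by decide) (by decide) (by decide)
  have huniq : ∀ S' : Finset (Fin n),
      (∀ v, v ∈ S' ↔ Candidate G (degreeCore G k u) y (prices n τ) l v) → S' = S :=
    fun S' hS' => Finset.ext fun v => (hS' v).trans (hmem v).symm
  have hcond : (Expr.and (.lt (.count 5 (candidateE 5)) (.var 8)) validE).Holds n τ ↔
      S.card < τ.reg 8 ∧ TransitiveOutside G S := by
    rw [Expr.holds_and, Expr.holds_lt, hvalid, hcard, Expr.eval]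
  by_cases hc : S.card < τ.reg 8 ∧ TransitiveOutside G S
  · suffices hbest : Best G S.card (keepS.run n τ) from
      ⟨⟨hbest.mem, hbest.valid, hbest.card_le, hbest.le.trans (hc.1.le.trans hb.le)⟩,
        fun S' hS' _ => by rw [huniq S' hS']; exact hbest⟩
    rw [keepS, Stmt.run, if_pos (show 0 < _ from hcond.2 hc), Stmt.run, Stmt.run, hcard]
    -- The candidate is evaluated while it is being written. Prices, level and context survive the
    -- writes to bank `1`, so `candidateE` keeps describing the same set.
    obtain ⟨hctx, hl', h8, hp, hout⟩ := Stmt.run_loop_induction (n := n) (v := 5)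
      (p := .store 1 (.var 5) (candidateE 5)) (σ := τ.setReg 8 S.card)
      (fun j ρ => Context G k u y ρ ∧ ρ.reg 7 = l ∧ ρ.reg 8 = S.card ∧
        prices n ρ = prices n τ ∧ ∀ v : Fin n, (v : ℕ) < j → (ρ.mem 1 v ≠ 0 ↔ v ∈ S))
      ⟨h.setReg (by omega) _, by simpa using hl, by simp, rfl, by simp⟩ fun j hj ρ hρ => by
        obtain ⟨hctx, hl', h8, hp, hout⟩ := hρ
        have hctx' := hctx.setReg (i := 5) (by omega) j
        have hcand := hctx'.holds_candidateE (i := 5) (l := l) (v := ⟨j, hj⟩) (by simpa using hl')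
          (by simp) (by decide) (by decide) (by decide)
        change _ ↔ Candidate G (degreeCore G k u) y (prices n ρ) l _ at hcand
        rw [hp, ← hmem, Expr.Holds, Nat.pos_iff_ne_zero] at hcand
        refine ⟨hctx'.run ?_ ?_ ?_ ?_, ?_, ?_, ?_, ?_⟩
        any_goals simp [Stmt.WritesBank, Stmt.WritesVar]
        · rw [Stmt.reg_run (by simp [Stmt.WritesVar])]
          simpa using hl'
        · rw [Stmt.reg_run (by simp [Stmt.WritesVar])]
          simpa using h8
        · rw [← hp]
          funext x
          exact congrFun (Stmt.mem_run (by simp [Stmt.WritesBank]) _) x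
        · intro v hv
          rw [Stmt.run, State.mem_setMem]
          by_cases hvj : (v : ℕ) = j
          · rw [if_pos (by simp [Expr.eval, hvj])]
            subst hvj
            exact hcand
          · rw [if_neg (by simp [Expr.eval, hvj])]
            exact hout v (by omega)
    have hset : vertexSetOutput n ((Stmt.loop 5 (.store 1 (.var 5) (candidateE 5))).run n
        (τ.setReg 8 S.card)) = S := Finset.ext fun v => by
      simpa [vertexSetOutput] using hout v v.2
    exact ⟨hctx.mem, by rw [hset]; exact hc.2, by rw [hset, h8], h8.le⟩
  · have hrun : keepS.run n τ = τ := by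
      rw [keepS, Stmt.run]
      exact if_neg (mt hcond.1 hc)
    rw [hrun]
    refine ⟨hb, fun S' hS' hT => ⟨hb.mem, hb.valid, hb.card_le, ?_⟩⟩
    rw [huniq S' hS'] at hT ⊢
    exact not_lt.1 fun hlt => hc ⟨hlt, hT⟩

theorem keepS_writes : ¬ keepS.WritesBank 0 ∧ ¬ keepS.WritesBank 2 ∧
    ∀ v, v ≠ 5 → v ≠ 8 → ¬ keepS.WritesVar v := by
  refine ⟨by simp [keepS, Stmt.WritesBank], by simp [keepS, Stmt.WritesBank], fun v h5 h8 => ?_⟩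
  simp [keepS, Stmt.WritesVar, h5, h8]

theorem centreS_writes (v : ℕ) (hv : v < 4) (hv0 : v ≠ 0) : ¬ centreS.WritesVar v := by
  interval_cases v <;>
    simp_all [centreS, resetS, auctionS, roundS, bidS, keepS, Stmt.WritesVar]

theorem Context.run_keepS_setReg {k : ℕ} {u y l : Fin n} {τ : State} (h : Context G k u y τ) :
    Context G k u y (keepS.run n (τ.setReg 7 l)) :=
  (h.setReg (by omega) _).run keepS_writes.1 (keepS_writes.2.2 1 (by simp) (by simp))
    (keepS_writes.2.2 2 (by simp) (by simp)) (keepS_writes.2.2 3 (by simp) (by simp))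

theorem Context.run_centreS {k : ℕ} {u y : Fin n} {τ : State} (h : Context G k u y τ) {m : ℕ}
    (hb : Best G m τ) :
    Best G m (centreS.run n τ) ∧ ∀ T : Finset (Fin n),
      G.IsClique (degreeCore G k u) → G.IsIndepSet (degreeCore G k u)ᶜ →
      (∀ v ∈ degreeCore G k u, ¬ (v = y ∨ G.Adj v y) → v ∈ T) →
      (∀ v w, CoreEdge G (degreeCore G k u) y v w → v ∈ T ∨ w ∈ T) →
      Best G T.card (centreS.run n τ) := by
  have hr : Context G k u y (resetS.run n τ) := by
    apply h.run <;> simp [resetS, Stmt.WritesBank, Stmt.WritesVar]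
  have hbr : Best G m (resetS.run n τ) := by
    apply hb.run <;> simp [resetS, Stmt.WritesBank, Stmt.WritesVar]
  obtain ⟨ha, hstable⟩ := hr.run_auctionS (by
    rw [prices_run_resetS, owners_run_resetS]
    exact isAuction_zero _)
  have hc : Context G k u y (auctionS.run n (resetS.run n τ)) := by
    apply hr.run <;> simp [auctionS, roundS, bidS, Stmt.WritesBank, Stmt.WritesVar]
  have hba : Best G m (auctionS.run n (resetS.run n τ)) := by
    apply hbr.run <;> simp [auctionS, roundS, bidS, Stmt.WritesBank, Stmt.WritesVar]
  rw [centreS, Stmt.run, Stmt.run]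
  generalize auctionS.run n (resetS.run n τ) = ρ at ha hstable hc hba
  have hstep : ∀ (m : ℕ) (l : Fin n) (π : State), Context G k u y π ∧ Best G m π →
      Context G k u y (keepS.run n (π.setReg 7 l)) ∧ Best G m (keepS.run n (π.setReg 7 l)) :=
    fun m l π hπ => ⟨hπ.1.run_keepS_setReg, ((hπ.1.setReg (by omega) l).run_keepS
      (l := l) (by simp) (hπ.2.setReg (by simp) l)).1⟩
  refine ⟨(Stmt.run_loop_induction (fun _ π => Context G k u y π ∧ Best G m π) ⟨hc, hba⟩
    fun j hj => hstep m ⟨j, hj⟩).2, fun T hC hI hT hcover => ?_⟩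
  obtain ⟨l, hl⟩ := exists_candidate_card_le (.inr rfl) hT hcover ha hstable
  classical
  set S := Finset.univ.filter (Candidate G (degreeCore G k u) y (prices n ρ) l) with hS
  have hmem : ∀ v, v ∈ S ↔ Candidate G (degreeCore G k u) y (prices n ρ) l v := by simp [hS]
  -- Until level `l` is reached, `I` keeps the prices fixed, so that this iteration meets exactly
  -- `S`. Afterwards the bound `T.card` persists, because `hstep` preserves `Best` for every bound.
  refine (Stmt.run_loop_of_hit (n := n) (v := 7) (p := keepS) (σ := ρ)
    (I := fun π => prices n π = prices n ρ ∧ Context G k u y π ∧ Best G m π)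
    (J := fun π => Context G k u y π ∧ Best G T.card π) l
    (fun j π hπ => ⟨?_, hstep m j π hπ.2⟩) (hstep _) (fun π hπ => ?_) ⟨rfl, hc, hba⟩).2
  · rw [← hπ.1]
    funext x
    exact congrFun (Stmt.mem_run keepS_writes.2.1 _) x
  · refine ⟨hπ.2.1.run_keepS_setReg, ?_⟩
    have hbest := ((hπ.2.1.setReg (i := 7) (by omega) l).run_keepS (l := l) (by simp)
      (hπ.2.2.setReg (by simp) l)).2 S
      (by change ∀ v, v ∈ S ↔ Candidate G _ y (prices n π) l v; rw [hπ.1]; exact hmem)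
      (transitiveOutside_candidate hC hI hmem)
    exact ⟨hbest.mem, hbest.valid, hbest.card_le, hbest.le.trans (hl S hmem)⟩

/-- The iteration for the centre that `exists_centre` extracts from `T` brings the bound down to
`T.card`; the other centres can only improve it. -/
theorem run_loop_centreS {k : ℕ} {u : Fin n} {m : ℕ} {τ : State} (h1 : τ.reg 1 = k)
    (h2 : τ.reg 2 = u) (hb : Best G m τ) :
    Best G m ((Stmt.loop 3 centreS).run n τ) ∧ ∀ T : Finset (Fin n),
      G.IsClique (degreeCore G k u) → G.IsIndepSet (degreeCore G k u)ᶜ →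
      TransitiveOutside G T → Best G T.card ((Stmt.loop 3 centreS).run n τ) := by
  have hctx : ∀ (m : ℕ) (y : Fin n) (π : State), π.reg 1 = k ∧ π.reg 2 = u ∧ Best G m π →
      Context G k u y (π.setReg 3 y) := fun m y π hπ =>
    ⟨hπ.2.2.mem, by simpa using hπ.1, by simpa using hπ.2.1, by simp⟩
  have hregs : ∀ (y : Fin n) (π : State), π.reg 1 = k → π.reg 2 = u →
      (centreS.run n (π.setReg 3 y)).reg 1 = k ∧ (centreS.run n (π.setReg 3 y)).reg 2 = u := by
    intro y π h1 h2
    rw [Stmt.reg_run (centreS_writes 1 (by simp) (by simp)),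
      Stmt.reg_run (centreS_writes 2 (by simp) (by simp))]
    exact ⟨by simpa using h1, by simpa using h2⟩
  have hstep : ∀ (m : ℕ) (y : Fin n) (π : State), π.reg 1 = k ∧ π.reg 2 = u ∧ Best G m π →
      (centreS.run n (π.setReg 3 y)).reg 1 = k ∧ (centreS.run n (π.setReg 3 y)).reg 2 = u ∧
        Best G m (centreS.run n (π.setReg 3 y)) := fun m y π hπ =>
    have := hregs y π hπ.1 hπ.2.1
    ⟨this.1, this.2, ((hctx m y π hπ).run_centreS (hπ.2.2.setReg (by simp) y)).1⟩
  refine ⟨(Stmt.run_loop_induction (fun _ π => π.reg 1 = k ∧ π.reg 2 = u ∧ Best G m π)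
    ⟨h1, h2, hb⟩ fun j hj => hstep m ⟨j, hj⟩).2.2, fun T hC hI hT => ?_⟩
  obtain ⟨y, hy, hcover⟩ := exists_centre hC hI (u := u) (.inr rfl) hT
  exact (Stmt.run_loop_of_hit (I := fun π => π.reg 1 = k ∧ π.reg 2 = u ∧ Best G m π)
    (J := fun π => π.reg 1 = k ∧ π.reg 2 = u ∧ Best G T.card π) y (hstep m) (hstep _)
    (fun π hπ => have := hregs y π hπ.1 hπ.2.1
      ⟨this.1, this.2, ((hctx m y π hπ).run_centreS (hπ.2.2.setReg (by simp) y)).2 T hC hI hy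
        hcover⟩) ⟨h1, h2, hb⟩).2.2

theorem run_loop_loop_centreS {k : ℕ} {m : ℕ} {τ : State} (h1 : τ.reg 1 = k) (hb : Best G m τ) :
    Best G m ((Stmt.loop 2 (.loop 3 centreS)).run n τ) ∧ ∀ (u : Fin n) (T : Finset (Fin n)),
      G.IsClique (degreeCore G k u) → G.IsIndepSet (degreeCore G k u)ᶜ →
      TransitiveOutside G T → Best G T.card ((Stmt.loop 2 (.loop 3 centreS)).run n τ) := by
  have hreg : ∀ (u : Fin n) (π : State), π.reg 1 = k →
      ((Stmt.loop 3 centreS).run n (π.setReg 2 u)).reg 1 = k := by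
    intro u π h1
    rw [Stmt.reg_run (by simpa [Stmt.WritesVar] using centreS_writes 1 (by simp) (by simp))]
    simpa using h1
  have hrun : ∀ (m : ℕ) (u : Fin n) (π : State), π.reg 1 = k ∧ Best G m π → _ :=
    fun m u π hπ => run_loop_centreS (τ := π.setReg 2 u) (k := k) (u := u) (by simpa using hπ.1)
      (by simp) (hπ.2.setReg (m := m) (by simp) u)
  have hstep : ∀ (m : ℕ) (u : Fin n) (π : State), π.reg 1 = k ∧ Best G m π →
      ((Stmt.loop 3 centreS).run n (π.setReg 2 u)).reg 1 = k ∧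
        Best G m ((Stmt.loop 3 centreS).run n (π.setReg 2 u)) := fun m u π hπ =>
    ⟨hreg u π hπ.1, (hrun m u π hπ).1⟩
  refine ⟨(Stmt.run_loop_induction (fun _ π => π.reg 1 = k ∧ Best G m π)
    ⟨h1, hb⟩ fun j hj => hstep m ⟨j, hj⟩).2, fun u T hC hI hT => ?_⟩
  exact (Stmt.run_loop_of_hit (I := fun π => π.reg 1 = k ∧ Best G m π)
    (J := fun π => π.reg 1 = k ∧ Best G T.card π) u (hstep m) (hstep _)
    (fun π hπ => ⟨hreg u π hπ.1, (hrun m u π hπ).2 T hC hI hT⟩) ⟨h1, hb⟩).2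

theorem best_run_initial {τ : State} (h : τ.mem 0 = (graphInput G).mem 0) :
    Best G n ((Stmt.loop 5 (.store 1 (.var 5) (.lit 1))).run n (τ.setReg 8 n)) := by
  obtain ⟨h0, h8, hout⟩ := Stmt.run_loop_induction (n := n) (v := 5)
    (p := .store 1 (.var 5) (.lit 1)) (σ := τ.setReg 8 n)
    (fun j ρ => ρ.mem 0 = (graphInput G).mem 0 ∧ ρ.reg 8 = n ∧ ∀ v < j, ρ.mem 1 v ≠ 0)
    ⟨h, by simp, by simp⟩ fun j hj ρ hρ => by
      refine ⟨?_, ?_, fun v hv => ?_⟩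
      · rw [Stmt.mem_run (by simp [Stmt.WritesBank])]
        exact hρ.1
      · rw [Stmt.reg_run (by simp [Stmt.WritesVar])]
        simpa using hρ.2.1
      · rw [Stmt.run, State.mem_setMem]
        by_cases hvj : v = j
        · simp [Expr.eval, hvj]
        · rw [if_neg (by simp [Expr.eval, hvj])]
          exact hρ.2.2 v (by omega)
  refine ⟨h0, fun a b c => .inl ?_, ?_, h8.le⟩
  · simpa [vertexSetOutput] using hout a a.2
  · rw [h8]
    exact (Finset.card_le_univ _).trans (by simp)

theorem run_deletionS (hG : IsSplit (Fin n) G) {τ : State}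
    (h : τ.mem 0 = (graphInput G).mem 0) :
    IsMinDeletionSet Is2K2P3Free G (vertexSetOutput n (deletionS.run n τ)) := by
  have hrun : deletionS.run n τ = (Stmt.loop 1 (.loop 2 (.loop 3 centreS))).run n
      ((Stmt.loop 5 (.store 1 (.var 5) (.lit 1))).run n (τ.setReg 8 n)) := by
    rw [deletionS, Stmt.run, Stmt.run, Stmt.run, Expr.eval_size]
  rw [hrun]
  have hinit := best_run_initial h
  generalize (Stmt.loop 5 (.store 1 (.var 5) (.lit 1))).run n (τ.setReg 8 n) = ρ at hinit
  have hstep : ∀ (m : ℕ) (k : Fin n) (π : State), Best G m π →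
      Best G m ((Stmt.loop 2 (.loop 3 centreS)).run n (π.setReg 1 k)) := fun m k π hπ =>
    (run_loop_loop_centreS (k := k) (by simp) (hπ.setReg (by simp) k)).1
  have hbest := Stmt.run_loop_induction (fun _ π => Best G n π) hinit
    fun j hj => hstep n ⟨j, hj⟩
  refine ⟨(isDeletionSet_iff hG _).2 hbest.valid, fun T hT => ?_⟩
  rw [isDeletionSet_iff hG] at hT
  -- With no vertices the loops never run and there is no `k` or `u` to guess, but the only vertex
  -- set is empty.
  rcases Nat.eq_zero_or_pos n with hn | hn
  · subst hn
    exact (Finset.card_le_univ _).trans (by simp)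
  · obtain ⟨k, u, hC, hI⟩ := exists_degreeCore hG hn
    have hfinal := Stmt.run_loop_of_hit (I := Best G n) (J := Best G T.card) k (hstep n) (hstep _)
      (fun π hπ => (run_loop_loop_centreS (k := k) (by simp) (hπ.setReg (by simp) k)).2 u T hC hI
        hT) hinit
    exact hfinal.card_le.trans hfinal.le

end RAM

theorem mainTheorem4 : VertexDeletionInP IsSplit Is2K2P3Free := by
  refine ⟨RAM.deletionS.compile 0, RAM.deletionS.time, fun n G hG => ?_⟩
  obtain ⟨s, t, he, ht, hr, -⟩ :=
    RAM.deletionS.exec_compile 0 _ _ (RAM.represents_graphInput G)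
  refine ⟨s, t, he, ht, ?_⟩
  rw [RAM.vertexSetOutput_congr (congrFun hr.mem 1)]
  exact RAM.run_deletionS hG rfl
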